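/- Let $E$ and $F$ be real Banach lattices. Operators are linear and bounded. The topological duals $E^*,F^*,F^{**}$ carry the operator norm and the dual order ($f\le g$ iff $f(x)\le g(x)$ for all $x\ge 0$), and $T^*\colon F^*\to E^*$ denotes the adjoint of $T\colon E\to F$. Definitions. Let $G$ be a Banach lattice and $X$ a Banach space. The lattice $G$ has the positive Schur property if every weakly null sequence of positive vectors of $G$ is norm null. It has order continuous norm if every decreasing net in $G$ with infimum $0$ converges to $0$ in norm. A vector $u>0$ of $G$ is discrete if every $x\in G$ with $|x|\le u$ is a scalar multiple of $u$, and $G$ is discrete if for every $x>0$ in $G$ there is a discrete vector $u\le x$. A subset $A\subseteq G$ is disjoint weakly compact if it is norm bounded and every sequence $(x_n)$ in its solid hull $\{x\in G: |x|\le|y| \text{ for some } y\in A\}$ with $|x_m|\wedge|x_n|=0$ for all $m\ne n$ is weakly null. An operator $T\colon G\to X$ is $DW$-compact if it maps disjoint weakly compact subsets of $G$ to relatively compact subsets of $X$, and $AM$-compact if it maps order bounded subsets of $G$ to relatively compact subsets of $X$. An operator between Banach lattices is positive if it maps positive vectors to positive vectors, and regular if it is the difference of two positive operators. Theorem. Consider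 the following assertions about $E$ and $F$. (i) $F$ has the positive Schur property. (ii) Every regular operator $T\colon E\to F$ such that $T^*$ is $AM$-compact is $DW$-compact. (iii) Every regular operator $T\colon E\to F$ such that $T^*$ is $DW$-compact is $DW$-compact. (iv) Every positive operator $T\colon E\to F$ such that $T^*$ is $DW$-compact is $DW$-compact. (v) At least one of the following holds: (a) $F$ has order continuous norm; (b) $E^*$ is discrete; (c) the norm of $E^*$ is not order continuous and $F^{**}$ is not discrete. Then (i) $\Rightarrow$ (ii) $\Rightarrow$ (iii) $\Rightarrow$ (iv) $\Rightarrow$ (v). -/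

import Mathlib

open Set Filter Topology

/-!
A (real) Banach lattice `E` is expressed by Mathlib's classes
`[NormedAddCommGroup E] [NormedSpace ℝ E] [CompleteSpace E] [Lattice E] [IsOrderedAddMonoid E]
[IsOrderedModule ℝ E] [HasSolidNorm E]`.  The topological dual is `StrongDual ℝ E`, with the
operator norm; the section below makes it a Banach lattice for the usual dual order.
-/

section DualLattice

set_option linter.unusedSectionVars false

variable {E : Type*} [NormedAddCommGroup E] [NormedSpace ℝ E] [Lattice E]
  [IsOrderedAddMonoid E] [HasSolidNorm E]

/-- The order of the dual: `f ≤ g` iff `f x ≤ g x` for all `x ≥ 0`. -/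
instance dualPartialOrder : PartialOrder (StrongDual ℝ E) where
  le f g := ∀ x : E, 0 ≤ x → f x ≤ g x
  le_refl f x _ := le_refl (f x)
  le_trans f g h hfg hgh x hx := (hfg x hx).trans (hgh x hx)
  le_antisymm f g hfg hgf := by
    ext x
    have h : ∀ y : E, 0 ≤ y → f y = g y := fun y hy => le_antisymm (hfg y hy) (hgf y hy)
    rw [← posPart_sub_negPart x, map_sub, map_sub, h _ (posPart_nonneg x), h _ (negPart_nonneg x)]

theorem dual_le_iff {f g : StrongDual ℝ E} : f ≤ g ↔ ∀ x : E, 0 ≤ x → f x ≤ g x := Iff.rfl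

theorem norm_le_of_mem_Icc {x y : E} (hy : y ∈ Icc 0 x) : ‖y‖ ≤ ‖x‖ := by
  apply norm_le_norm_of_abs_le_abs
  rw [abs_of_nonneg hy.1, abs_of_nonneg (hy.1.trans hy.2)]
  exact hy.2

theorem dual_image_Icc_bddAbove (f : StrongDual ℝ E) (x : E) : BddAbove (f '' Icc 0 x) := by
  refine ⟨‖f‖ * ‖x‖, ?_⟩
  rintro _ ⟨y, hy, rfl⟩
  calc f y ≤ ‖f y‖ := Real.le_norm_self _
    _ ≤ ‖f‖ * ‖y‖ := f.le_opNorm y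
    _ ≤ ‖f‖ * ‖x‖ := by gcongr; exact norm_le_of_mem_Icc hy

/-- The positive part of a functional on the positive cone: `x ↦ sup {f y : 0 ≤ y ≤ x}`. -/
noncomputable def dualPosCone (f : StrongDual ℝ E) (x : E) : ℝ := sSup (f '' Icc 0 x)

theorem le_dualPosCone (f : StrongDual ℝ E) {x y : E} (hy : y ∈ Icc 0 x) :
    f y ≤ dualPosCone f x :=
  le_csSup (dual_image_Icc_bddAbove f x) (mem_image_of_mem f hy)

theorem dualPosCone_le (f : StrongDual ℝ E) {x : E} (hx : 0 ≤ x) {c : ℝ}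
    (h : ∀ y ∈ Icc 0 x, f y ≤ c) : dualPosCone f x ≤ c := by
  have h0 : (0 : E) ∈ Icc 0 x := ⟨le_rfl, hx⟩
  refine csSup_le ⟨f 0, mem_image_of_mem f h0⟩ ?_
  rintro _ ⟨y, hy, rfl⟩
  exact h y hy

theorem dualPosCone_nonneg (f : StrongDual ℝ E) {x : E} (hx : 0 ≤ x) : 0 ≤ dualPosCone f x := by
  simpa using le_dualPosCone f (x := x) (y := 0) (left_mem_Icc.2 hx)

theorem dualPosCone_le_norm (f : StrongDual ℝ E) {x : E} (hx : 0 ≤ x) :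
    dualPosCone f x ≤ ‖f‖ * ‖x‖ := by
  refine dualPosCone_le f hx fun y hy => ?_
  calc f y ≤ ‖f y‖ := Real.le_norm_self _
    _ ≤ ‖f‖ * ‖y‖ := f.le_opNorm y
    _ ≤ ‖f‖ * ‖x‖ := by gcongr; exact norm_le_of_mem_Icc hy

theorem dualPosCone_add (f : StrongDual ℝ E) {x y : E} (hx : 0 ≤ x) (hy : 0 ≤ y) :
    dualPosCone f (x + y) = dualPosCone f x + dualPosCone f y := by
  apply le_antisymm
  · refine dualPosCone_le f (add_nonneg hx hy) fun z hz => ?_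
    have h1 : z ⊓ x ∈ Icc 0 x := ⟨le_inf hz.1 hx, inf_le_right⟩
    have h2 : z - z ⊓ x ∈ Icc 0 y := by
      refine ⟨sub_nonneg.2 inf_le_left, ?_⟩
      rw [sub_le_iff_le_add, add_inf]
      exact le_inf (le_add_of_nonneg_left hy) (by rw [add_comm]; exact hz.2)
    have h3 : f z = f (z ⊓ x) + f (z - z ⊓ x) := by rw [← map_add]; congr 1; abel
    rw [h3]
    exact add_le_add (le_dualPosCone f h1) (le_dualPosCone f h2)
  · rw [← le_sub_iff_add_le]
    refine dualPosCone_le f hx fun u hu => ?_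
    rw [le_sub_comm]
    refine dualPosCone_le f hy fun v hv => ?_
    rw [le_sub_iff_add_le', ← map_add]
    exact le_dualPosCone f ⟨add_nonneg hu.1 hv.1, add_le_add hu.2 hv.2⟩

theorem dualPosCone_sub_eq (f : StrongDual ℝ E) {a b c d : E} (ha : 0 ≤ a) (hb : 0 ≤ b)
    (hc : 0 ≤ c) (hd : 0 ≤ d) (h : a - b = c - d) :
    dualPosCone f a - dualPosCone f b = dualPosCone f c - dualPosCone f d := by
  have h1 : a + d = c + b := by
    rw [sub_eq_sub_iff_add_eq_add] at h
    exact h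
  have h2 := congrArg (dualPosCone f) h1
  rw [dualPosCone_add f ha hd, dualPosCone_add f hc hb] at h2
  linarith

/-- The positive part of a functional (Riesz–Kantorovich), as a continuous functional. -/
noncomputable def dualPos (f : StrongDual ℝ E) : StrongDual ℝ E :=
  AddMonoidHom.toRealLinearMap
    (AddMonoidHom.mk' (fun x : E => dualPosCone f (x⁺) - dualPosCone f (x⁻)) (by
      intro x y
      have h := dualPosCone_sub_eq f (posPart_nonneg (x + y)) (negPart_nonneg (x + y))
        (add_nonneg (posPart_nonneg x) (posPart_nonneg y))
        (add_nonneg (negPart_nonneg x) (negPart_nonneg y))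
        (by rw [posPart_sub_negPart, add_sub_add_comm, posPart_sub_negPart, posPart_sub_negPart])
      rw [dualPosCone_add f (posPart_nonneg x) (posPart_nonneg y),
        dualPosCone_add f (negPart_nonneg x) (negPart_nonneg y)] at h
      linarith))
    (AddMonoidHomClass.continuous_of_bound _ ‖f‖ (by
      intro x
      have key : ∀ z : E, 0 ≤ z → |z| ≤ |x| → dualPosCone f z ≤ ‖f‖ * ‖x‖ := fun z hz hzx =>
        (dualPosCone_le_norm f hz).trans (by gcongr; exact norm_le_norm_of_abs_le_abs hzx)
      have h1 := key _ (posPart_nonneg x) (by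
        rw [abs_of_nonneg (posPart_nonneg x), ← posPart_add_negPart x]
        exact le_add_of_nonneg_right (negPart_nonneg x))
      have h2 := key _ (negPart_nonneg x) (by
        rw [abs_of_nonneg (negPart_nonneg x), ← posPart_add_negPart x]
        exact le_add_of_nonneg_left (posPart_nonneg x))
      have h3 := dualPosCone_nonneg f (posPart_nonneg x)
      have h4 := dualPosCone_nonneg f (negPart_nonneg x)
      rw [Real.norm_eq_abs, abs_le]
      simp only [AddMonoidHom.mk'_apply]
      constructor <;> linarith))

theorem dualPos_apply_of_nonneg (f : StrongDual ℝ E) {x : E} (hx : 0 ≤ x) :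
    dualPos f x = dualPosCone f x := by
  have h : dualPos f x = dualPosCone f (x⁺) - dualPosCone f (x⁻) := rfl
  rw [h, posPart_of_nonneg hx, negPart_of_nonneg hx]
  have h0 : dualPosCone f (0 : E) = 0 := by simp [dualPosCone]
  rw [h0, sub_zero]

theorem le_dualPos (f : StrongDual ℝ E) : f ≤ dualPos f := fun x hx => by
  rw [dualPos_apply_of_nonneg f hx]
  exact le_dualPosCone f ⟨hx, le_rfl⟩

theorem dualPos_nonneg (f : StrongDual ℝ E) : 0 ≤ dualPos f := fun x hx => by
  rw [dualPos_apply_of_nonneg f hx]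
  exact dualPosCone_nonneg f hx

theorem dualPos_le {f g : StrongDual ℝ E} (hg : 0 ≤ g) (hfg : f ≤ g) : dualPos f ≤ g :=
  fun x hx => by
    rw [dualPos_apply_of_nonneg f hx]
    refine dualPosCone_le f hx fun y hy => (hfg y hy.1).trans ?_
    have h := hg (x - y) (sub_nonneg.2 hy.2)
    rw [map_sub] at h
    simpa using h

instance dualIsOrderedAddMonoid : IsOrderedAddMonoid (StrongDual ℝ E) where
  add_le_add_left f g h k x hx := by
    have := h x hx
    simpa using this

instance dualIsOrderedModule : IsOrderedModule ℝ (StrongDual ℝ E) where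
  smul_le_smul_of_nonneg_left c hc f g h x hx := by
    simpa using mul_le_mul_of_nonneg_left (h x hx) hc
  smul_le_smul_of_nonneg_right f hf c d h x hx := by
    have := hf x hx
    simpa using mul_le_mul_of_nonneg_right h this

/-- The lattice structure of the dual for its order; the operations are forced by the order. -/
noncomputable instance dualLattice : Lattice (StrongDual ℝ E) where
  __ := dualPartialOrder
  sup f g := f + dualPos (g - f)
  inf f g := f - dualPos (f - g)
  le_sup_left f g := le_add_of_nonneg_right (dualPos_nonneg _)
  le_sup_right f g := by
    have h := le_dualPos (g - f)
    rwa [sub_le_iff_le_add'] at h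
  sup_le f g h hf hg := by
    change f + dualPos (g - f) ≤ h
    rw [← le_sub_iff_add_le']
    exact dualPos_le (sub_nonneg.2 hf) (sub_le_sub_right hg f)
  inf_le_left f g := sub_le_self f (dualPos_nonneg _)
  inf_le_right f g := by
    have h := le_dualPos (f - g)
    rwa [sub_le_comm] at h
  le_inf h f g hf hg := by
    change h ≤ f - dualPos (f - g)
    rw [le_sub_comm]
    exact dualPos_le (sub_nonneg.2 hf) (sub_le_sub_left hg f)

theorem dual_abs_apply_of_nonneg (f : StrongDual ℝ E) {x : E} (hx : 0 ≤ x) :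
    |f| x = f x + dualPosCone (-f - f) x := by
  have h : |f| = f + dualPos (-f - f) := rfl
  rw [h, _root_.add_apply, dualPos_apply_of_nonneg _ hx]

theorem dual_abs_apply_le (f : StrongDual ℝ E) {x : E} (hx : 0 ≤ x) : |f| x ≤ ‖f‖ * ‖x‖ := by
  rw [dual_abs_apply_of_nonneg f hx, ← le_sub_iff_add_le']
  refine dualPosCone_le _ hx fun y hy => ?_
  have h1 : f x + (-f - f) y = f (x - y - y) := by
    simp only [_root_.sub_apply, _root_.neg_apply, map_sub]
    ring
  rw [le_sub_iff_add_le', h1]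
  have h2 : |x - y - y| ≤ |x| := by
    rw [abs_of_nonneg hx, abs_le']
    constructor
    · rw [sub_sub]
      exact sub_le_self x (add_nonneg hy.1 hy.1)
    · have : -(x - y - y) = y + y - x := by abel
      rw [this, sub_le_iff_le_add]
      exact add_le_add hy.2 hy.2
  calc f (x - y - y) ≤ ‖f (x - y - y)‖ := Real.le_norm_self _
    _ ≤ ‖f‖ * ‖x - y - y‖ := f.le_opNorm _
    _ ≤ ‖f‖ * ‖x‖ := by gcongr; exact norm_le_norm_of_abs_le_abs h2

theorem dual_abs_le_abs_apply (f : StrongDual ℝ E) (x : E) : |f x| ≤ |f| |x| := by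
  have h1 : ∀ u : E, 0 ≤ u → |f u| ≤ |f| u := fun u hu =>
    abs_le'.2 ⟨(le_abs_self f) u hu, by simpa using (neg_le_abs f) u hu⟩
  have h2 : |f x| ≤ |f (x⁺)| + |f (x⁻)| := by
    conv_lhs => rw [← posPart_sub_negPart x, map_sub]
    exact abs_sub _ _
  rw [← posPart_add_negPart x, map_add]
  exact h2.trans (add_le_add (h1 _ (posPart_nonneg x)) (h1 _ (negPart_nonneg x)))

instance dualHasSolidNorm : HasSolidNorm (StrongDual ℝ E) where
  solid f g h := by
    refine f.opNorm_le_bound (norm_nonneg g) fun x => ?_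
    rw [Real.norm_eq_abs]
    calc |f x| ≤ |f| |x| := dual_abs_le_abs_apply f x
      _ ≤ |g| |x| := h |x| (abs_nonneg x)
      _ ≤ ‖g‖ * ‖|x|‖ := dual_abs_apply_le g (abs_nonneg x)
      _ = ‖g‖ * ‖x‖ := by rw [norm_abs_eq_norm]

end DualLattice

section Notions

/-- The sequence `x` converges weakly to `0`. -/
def WeaklyNull {X : Type*} [NormedAddCommGroup X] [NormedSpace ℝ X] (x : ℕ → X) : Prop :=
  ∀ f : StrongDual ℝ X, Tendsto (fun n => f (x n)) atTop (𝓝 0)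

/-- The terms of the sequence are pairwise disjoint: `|x m| ∧ |x n| = 0` for `m ≠ n`. -/
def DisjointSeq {E : Type*} [AddCommGroup E] [Lattice E] (x : ℕ → E) : Prop :=
  Pairwise fun m n => |x m| ⊓ |x n| = 0

/-- A norm bounded set such that every disjoint sequence in its solid hull
`{x | ∃ y ∈ A, |x| ≤ |y|}` is weakly null. -/
def DisjointWeaklyCompact {E : Type*} [NormedAddCommGroup E] [NormedSpace ℝ E] [Lattice E]
    (A : Set E) : Prop :=
  Bornology.IsBounded A ∧
    ∀ x : ℕ → E, (∀ n, x n ∈ LatticeOrderedAddCommGroup.solidClosure A) → DisjointSeq x →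
      WeaklyNull x

/-- Disjoint weakly compact sets are mapped to relatively compact sets. -/
def DWCompact {E X : Type*} [NormedAddCommGroup E] [NormedSpace ℝ E] [Lattice E]
    [NormedAddCommGroup X] [NormedSpace ℝ X] (T : E →L[ℝ] X) : Prop :=
  ∀ A : Set E, DisjointWeaklyCompact A → IsCompact (closure (T '' A))

/-- Order bounded sets are mapped to relatively compact sets. -/
def AMCompact {E X : Type*} [NormedAddCommGroup E] [NormedSpace ℝ E] [Lattice E]
    [NormedAddCommGroup X] [NormedSpace ℝ X] (T : E →L[ℝ] X) : Prop :=
  ∀ A : Set E, BddBelow A → BddAbove A → IsCompact (closure (T '' A))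

def PositiveOperator {E F : Type*} [NormedAddCommGroup E] [NormedSpace ℝ E] [Lattice E]
    [NormedAddCommGroup F] [NormedSpace ℝ F] [Lattice F] (T : E →L[ℝ] F) : Prop :=
  ∀ x : E, 0 ≤ x → 0 ≤ T x

/-- A difference of two positive operators. -/
def RegularOperator {E F : Type*} [NormedAddCommGroup E] [NormedSpace ℝ E] [Lattice E]
    [NormedAddCommGroup F] [NormedSpace ℝ F] [Lattice F] (T : E →L[ℝ] F) : Prop :=
  ∃ S₁ S₂ : E →L[ℝ] F, PositiveOperator S₁ ∧ PositiveOperator S₂ ∧ T = S₁ - S₂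

/-- The Banach space adjoint `T* : F* → E*`, `T* g = g ∘ T`. -/
noncomputable def adjointOperator {E F : Type*} [NormedAddCommGroup E] [NormedSpace ℝ E]
    [NormedAddCommGroup F] [NormedSpace ℝ F] (T : E →L[ℝ] F) :
    StrongDual ℝ F →L[ℝ] StrongDual ℝ E :=
  ContinuousLinearMap.precomp ℝ T

/-- Every weakly null sequence of positive vectors is norm null. -/
def PositiveSchur (E : Type*) [NormedAddCommGroup E] [NormedSpace ℝ E] [Lattice E] : Prop :=
  ∀ x : ℕ → E, (∀ n, 0 ≤ x n) → WeaklyNull x → Tendsto x atTop (𝓝 0)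

/-- Every decreasing net with infimum `0` converges to `0` in norm.  A downward directed set `D`
is regarded as a decreasing net indexed by itself. -/
def OrderContinuousNorm (E : Type*) [NormedAddCommGroup E] [Lattice E] : Prop :=
  ∀ D : Set E, D.Nonempty → DirectedOn (· ≥ ·) D → IsGLB D 0 →
    Tendsto (fun x : D => ‖(x : E)‖) atBot (𝓝 0)

/-- A discrete vector (atom): `u > 0` and the order ideal generated by `u` is the line
spanned by `u`. -/
def DiscreteVector {E : Type*} [NormedAddCommGroup E] [NormedSpace ℝ E] [Lattice E]
    (u : E) : Prop :=
  0 < u ∧ ∀ x : E, |x| ≤ u → ∃ c : ℝ, x = c • u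

/-- Every vector `x > 0` dominates a discrete vector. -/
def DiscreteLattice (E : Type*) [NormedAddCommGroup E] [NormedSpace ℝ E] [Lattice E] : Prop :=
  ∀ x : E, 0 < x → ∃ u : E, DiscreteVector u ∧ u ≤ x

end Notions

/-!
The four implications rest on the behaviour of disjoint sequences.

*The positive Schur property makes regular operators with AM-compact adjoint DW-compact.* Let
`T = S₁ - S₂` with `S₁, S₂` positive, `S = S₁ + S₂`, and let `A` be disjoint weakly
compact. Positive disjoint sequences in the solid hull of `A` are weakly null, so `S` sends them to
norm null sequences by the positive Schur property. Hence up to a set on which `S`, and so `T`, is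
small, `A` lies in an order interval `[-u, u]` (`exists_norm_apply_posPart_le`). Compactness of
`T* [-g, g]` makes `T [-u, u]` totally bounded for the seminorm `y ↦ g |y|`
(`exists_finite_net_of_totallyBounded_adjoint`), and on the order interval `[-S u, S u]` a single
such seminorm controls the norm (`OrderBoundedDisjointNull.exists_dual_controlling_norm`).

*The two middle implications.* Order bounded sets are disjoint weakly compact, so DW-compact
operators are AM-compact; and positive operators are regular.

*The necessary condition.* The proof yields more than stated: the norm of `F` is order
continuous or `E*` is discrete. If the norm of `F` is not order continuous, there is a disjoint sequence `y n` in some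
`[0, w]` with norms bounded below; this uses a level-crossing decomposition of the jumps of an
increasing sequence (`OrderBoundedDisjointNull.tendsto_sub`). If `E*` is not discrete, an atomless
functional can be split repeatedly into components of equal mass, the components being extreme
points of weak-star compact sets (`exists_component_halving`), and the resulting Rademacher
functions `r n` have a common modulus `f ≠ 0` but tend weak-star to `0` by Bessel's inequality
(`exists_rademacher`). Then `T x = f x • w + ∑ r n x • y n` is positive and is not DW-compact, since
`r n x → 0` is not uniform on an order interval. Its adjoint `g ↦ g w • f + ∑ g (y n) • r n` is
DW-compact, since on a disjoint weakly compact set the tails of `∑ |g (y n)|` are uniformly small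
(`DisjointWeaklyCompact.exists_tail_sum_le`).
-/

/-! ### Disjointness in vector lattices -/

section VectorLattice

set_option linter.unusedSectionVars false

variable {G : Type*} [AddCommGroup G] [Lattice G] [IsOrderedAddMonoid G]

theorem inf_add_le_inf_add_inf {a b c : G} (ha : 0 ≤ a) (hb : 0 ≤ b) (hc : 0 ≤ c) :
    a ⊓ (b + c) ≤ a ⊓ b + a ⊓ c := by
  rw [inf_add, add_inf, add_inf]
  refine le_inf (le_inf ?_ ?_) (le_inf ?_ inf_le_right)
  · exact inf_le_left.trans (le_add_of_nonneg_left ha)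
  · exact inf_le_left.trans (le_add_of_nonneg_right hc)
  · exact inf_le_left.trans (le_add_of_nonneg_left hb)

theorem inf_sum_eq_zero {ι : Type*} {s : Finset ι} {a : G} {b : ι → G} (ha : 0 ≤ a)
    (hb : ∀ i ∈ s, 0 ≤ b i) (h : ∀ i ∈ s, a ⊓ b i = 0) : a ⊓ ∑ i ∈ s, b i = 0 := by
  classical
  induction s using Finset.induction_on with
  | empty => simpa using ha
  | insert i s hi ih =>
    rw [Finset.sum_insert hi]
    have hs : ∀ j ∈ s, 0 ≤ b j := fun j hj => hb j (Finset.mem_insert_of_mem hj)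
    have hi0 := hb i (Finset.mem_insert_self i s)
    refine le_antisymm ((inf_add_le_inf_add_inf ha hi0 (Finset.sum_nonneg hs)).trans ?_)
      (le_inf ha (add_nonneg hi0 (Finset.sum_nonneg hs)))
    rw [h i (Finset.mem_insert_self i s), zero_add,
      ih hs fun j hj => h j (Finset.mem_insert_of_mem hj)]

theorem sum_inf_sum_eq_zero {ι κ : Type*} {s : Finset ι} {t : Finset κ} {a : ι → G} {b : κ → G}
    (ha : ∀ i ∈ s, 0 ≤ a i) (hb : ∀ j ∈ t, 0 ≤ b j) (h : ∀ i ∈ s, ∀ j ∈ t, a i ⊓ b j = 0) :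
    (∑ i ∈ s, a i) ⊓ ∑ j ∈ t, b j = 0 := by
  refine inf_sum_eq_zero (Finset.sum_nonneg ha) hb fun j hj => ?_
  rw [inf_comm]
  exact inf_sum_eq_zero (hb j hj) ha fun i hi => by rw [inf_comm]; exact h i hi j hj

theorem inf_eq_zero_of_le {a b c d : G} (h : c ⊓ d = 0) (ha : 0 ≤ a) (hb : 0 ≤ b) (hac : a ≤ c)
    (hbd : b ≤ d) : a ⊓ b = 0 :=
  le_antisymm ((inf_le_inf hac hbd).trans h.le) (le_inf ha hb)

theorem add_le_of_inf_eq_zero {a b y : G} (h : a ⊓ b = 0) (ha : a ≤ y) (hb : b ≤ y) :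
    a + b ≤ y := by
  rw [← inf_add_sup, h, zero_add]
  exact sup_le ha hb

theorem sum_le_of_pairwise_inf_eq_zero {ι : Type*} {b : ι → G} {y : G} (hb : ∀ i, 0 ≤ b i)
    (hy : ∀ i, b i ≤ y) (h0 : 0 ≤ y) (h : Pairwise fun i j => b i ⊓ b j = 0) (s : Finset ι) :
    ∑ i ∈ s, b i ≤ y := by
  classical
  induction s using Finset.induction_on with
  | empty => simpa using h0
  | insert i s hi ih =>
    rw [Finset.sum_insert hi]
    refine add_le_of_inf_eq_zero (inf_sum_eq_zero (hb i) (fun j _ => hb j) fun j hj => h ?_)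
      (hy i) ih
    rintro rfl
    exact hi hj

theorem disjointSeq_iff_of_nonneg {x : ℕ → G} (hx : ∀ n, 0 ≤ x n) :
    DisjointSeq x ↔ Pairwise fun m n => x m ⊓ x n = 0 := by
  simp only [DisjointSeq, abs_of_nonneg (hx _)]

theorem pairwise_of_lt_of_inf {x : ℕ → G} (h : ∀ m n, m < n → x m ⊓ x n = 0) :
    Pairwise fun m n => x m ⊓ x n = 0 := by
  intro m n hmn
  rcases lt_or_gt_of_ne hmn with h' | h'
  · exact h m n h'
  · rw [inf_comm]
    exact h n m h'

theorem abs_sub_eq_add_of_inf_eq_zero {a b : G} (h : a ⊓ b = 0) : |a - b| = a + b := by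
  have h1 := inf_add_sup a b
  rw [h, zero_add] at h1
  have h2 : |a - b| = a ⊔ b - a ⊓ b := by
    rw [sup_sub_inf_eq_abs_sub, abs_sub_comm]
  rw [h2, h, sub_zero, h1]

theorem posPart_sub_le_posPart_sub {a b c d : G} (h1 : a ≤ c) (h2 : d ≤ b) :
    (a - b)⁺ ≤ (c - d)⁺ :=
  posPart_mono (sub_le_sub h1 h2)

/-- The positive parts of `a - b` and `b - a` are disjoint; this persists when `c - d` lies below
`b - a` because `c ≤ b` and `a ≤ d`. -/
theorem posPart_sub_inf_posPart_sub {a b c d : G} (h1 : a ≤ d) (h2 : c ≤ b) :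
    (a - b)⁺ ⊓ (c - d)⁺ = 0 := by
  refine inf_eq_zero_of_le (posPart_inf_negPart_eq_zero (a - b)) (posPart_nonneg _)
    (posPart_nonneg _) le_rfl ?_
  rw [← posPart_neg, neg_sub]
  exact posPart_sub_le_posPart_sub h2 h1

/-- Crossing of a level: if an increasing pair `a ≤ b` is cut at heights `l` and `l + u`, the part
of the jump below `l + u` exceeds the part below `l` (or `u`) by at most the part of the jump that
straddles `l`. -/
theorem posPart_inf_add_sub_le (a b l u : G) (hu : 0 ≤ u) :
    (b ⊓ (l + u) - a)⁺ ≤ (b - l)⁺ ⊓ (l - a)⁺ + u ⊔ (b ⊓ l - a)⁺ := by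
  rw [inf_add]
  refine le_inf ?_ ?_
  · have h1 : (b ⊓ (l + u) - a)⁺ ≤ (b - l)⁺ + (b ⊓ l - a)⁺ := by
      rw [posPart_def (b ⊓ (l + u) - a)]
      refine sup_le ?_ (add_nonneg (posPart_nonneg _) (posPart_nonneg _))
      have h2 : (b - l)⁺ + b ⊓ l = b := by
        rw [posPart_def, ← sub_self l, ← sup_sub, sub_add_eq_add_sub, add_comm, inf_add_sup,
          add_sub_cancel_right]
      calc b ⊓ (l + u) - a ≤ b - a := sub_le_sub_right inf_le_left a
        _ = (b - l)⁺ + (b ⊓ l - a) := by rw [add_sub, h2]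
        _ ≤ _ := by gcongr; exact le_posPart _
    exact h1.trans (by gcongr; exact le_sup_right)
  · calc (b ⊓ (l + u) - a)⁺ ≤ (l + u - a)⁺ := posPart_mono (sub_le_sub_right inf_le_right a)
      _ ≤ (l - a)⁺ + u := by
        rw [posPart_def (l + u - a)]
        refine sup_le ?_ (add_nonneg (posPart_nonneg _) hu)
        rw [add_sub_right_comm]
        gcongr
        exact le_posPart _
      _ ≤ _ := by gcongr; exact le_sup_left

variable [Module ℝ G] [IsOrderedModule ℝ G]

theorem smul_inf_of_pos {c : ℝ} (hc : 0 < c) (a b : G) : c • (a ⊓ b) = c • a ⊓ c • b :=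
  (OrderIso.smulRight (β := G) hc).map_inf a b

theorem smul_inf_eq_zero {c : ℝ} (hc : 0 ≤ c) {a b : G} (ha : 0 ≤ a) (hb : 0 ≤ b)
    (h : a ⊓ b = 0) : c • a ⊓ b = 0 := by
  have hM : (0 : ℝ) < max c 1 := lt_max_of_lt_right one_pos
  refine inf_eq_zero_of_le (c := max c 1 • a) (d := max c 1 • b) ?_ (smul_nonneg hc ha) hb
    (smul_le_smul_of_nonneg_right (le_max_left _ _) ha) ?_
  · rw [← smul_inf_of_pos hM, h, smul_zero]
  · simpa using smul_le_smul_of_nonneg_right (le_max_right c 1) hb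

/-- Two vectors that are reduced by multiples of each other become disjoint. -/
theorem posPart_sub_smul_inf_posPart_sub_smul {a b : G} {C D : ℝ} (hC : 0 < C) (hCD : 1 ≤ C * D)
    (ha : 0 ≤ a) : (a - C • b)⁺ ⊓ (b - D • a)⁺ = 0 := by
  have h1 : (C • (b - D • a))⁺ ⊓ (a - C • b)⁺ = 0 := by
    refine inf_eq_zero_of_le (posPart_inf_negPart_eq_zero (C • b - a)) (posPart_nonneg _)
      (posPart_nonneg _) ?_ ?_
    · rw [smul_sub, smul_smul]
      refine posPart_sub_le_posPart_sub le_rfl ?_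
      simpa using smul_le_smul_of_nonneg_right hCD ha
    · rw [← posPart_neg, neg_sub]
  have h2 : (b - D • a)⁺ = C⁻¹ • (C • (b - D • a))⁺ := by
    rw [posPart_def, posPart_def]
    have := (OrderIso.smulRight (β := G) (inv_pos.2 hC)).map_sup (C • (b - D • a)) 0
    simp only [OrderIso.smulRight_apply, smul_zero, inv_smul_smul₀ hC.ne'] at this
    exact this.symm
  rw [inf_comm, h2]
  exact smul_inf_eq_zero (inv_nonneg.2 hC.le) (posPart_nonneg _) (posPart_nonneg _) h1

theorem abs_smul_of_nonneg {c : ℝ} (hc : 0 ≤ c) (a : G) : |c • a| = c • |a| := by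
  rcases hc.eq_or_lt with rfl | hc
  · simp
  · have := (OrderIso.smulRight (β := G) hc).map_sup a (-a)
    simp only [OrderIso.smulRight_apply, smul_neg] at this
    exact this.symm

theorem abs_smul_le (c : ℝ) (a : G) : |c • a| ≤ |c| • |a| := by
  rcases le_total 0 c with hc | hc
  · rw [abs_smul_of_nonneg hc, abs_of_nonneg hc]
  · rw [← abs_neg (c • a), ← neg_smul, abs_smul_of_nonneg (neg_nonneg.2 hc), abs_of_nonpos hc]

end VectorLattice

/-! ### Order intervals and order continuity of the norm -/

section BanachLattice

set_option linter.unusedSectionVars false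

variable {F : Type*} [NormedAddCommGroup F] [NormedSpace ℝ F] [Lattice F]
  [IsOrderedAddMonoid F] [HasSolidNorm F]

theorem norm_le_norm_of_nonneg_of_le {a b : F} (ha : 0 ≤ a) (hab : a ≤ b) : ‖a‖ ≤ ‖b‖ :=
  norm_le_of_mem_Icc ⟨ha, hab⟩

theorem norm_le_norm_of_abs_le {a b : F} (h : |a| ≤ b) : ‖a‖ ≤ ‖b‖ := by
  rw [← norm_abs_eq_norm a]
  exact norm_le_norm_of_nonneg_of_le (abs_nonneg a) h

theorem dual_apply_mono {g : StrongDual ℝ F} (hg : 0 ≤ g) {x y : F} (hxy : x ≤ y) : g x ≤ g y := by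
  have := hg (y - x) (sub_nonneg.2 hxy)
  rw [map_sub] at this
  simpa using this

theorem abs_dual_apply_le_of_abs_le {g f : StrongDual ℝ F} (h : |g| ≤ f) (x : F) :
    |g x| ≤ f |x| :=
  (dual_abs_le_abs_apply g x).trans (h |x| (abs_nonneg x))

/-- A positive vector is normed by a positive functional of the dual unit ball. -/
theorem exists_nonneg_dual_vector (z : F) :
    ∃ g : StrongDual ℝ F, 0 ≤ g ∧ ‖g‖ ≤ 1 ∧ ‖z‖ ≤ g |z| := by
  obtain ⟨f, hf1, hf2⟩ := exists_dual_vector'' ℝ z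
  refine ⟨|f|, abs_nonneg f, by rwa [norm_abs_eq_norm], ?_⟩
  have h := abs_dual_apply_le_of_abs_le (le_refl |f|) z
  rw [hf2] at h
  exact (le_abs_self _).trans h

theorem summable_dual_apply_of_pairwise_inf_eq_zero {x : ℕ → F} {w : F} (hx : ∀ n, 0 ≤ x n)
    (hw : ∀ n, x n ≤ w) (hd : Pairwise fun m n => x m ⊓ x n = 0) {g : StrongDual ℝ F}
    (hg : 0 ≤ g) : Summable (fun n => g (x n)) := by
  refine summable_of_sum_le (c := g w) (fun n => hg _ (hx n)) fun s => ?_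
  rw [← map_sum]
  exact dual_apply_mono hg
    (sum_le_of_pairwise_inf_eq_zero hx hw ((hx 0).trans (hw 0)) hd s)

/-- Order bounded sets are disjoint weakly compact: on a disjoint order bounded sequence a
functional is absolutely summable. -/
theorem disjointWeaklyCompact_of_orderBounded {A : Set F} (h1 : BddBelow A) (h2 : BddAbove A) :
    DisjointWeaklyCompact A := by
  obtain ⟨l, hl⟩ := h1
  obtain ⟨u, hu⟩ := h2
  have hw : ∀ a ∈ A, |a| ≤ |l| + |u| := fun a ha => by
    refine abs_le'.2 ⟨?_, ?_⟩
    · exact (hu ha).trans ((le_abs_self u).trans (le_add_of_nonneg_left (abs_nonneg l)))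
    · exact (neg_le_neg (hl ha)).trans
        ((neg_le_abs l).trans (le_add_of_nonneg_right (abs_nonneg u)))
  refine ⟨?_, fun x hx hd f => ?_⟩
  · refine (isBounded_iff_forall_norm_le).2 ⟨‖|l| + |u|‖, fun a ha => ?_⟩
    exact norm_le_norm_of_abs_le (hw a ha)
  · have hs := summable_dual_apply_of_pairwise_inf_eq_zero (x := fun n => |x n|) (w := |l| + |u|)
      (fun n => abs_nonneg _) (fun n => by
        obtain ⟨a, ha, hxa⟩ := hx n
        exact hxa.trans (hw a ha)) hd (abs_nonneg f)
    exact squeeze_zero_norm (fun n => abs_dual_apply_le_of_abs_le le_rfl _) hs.tendsto_atTop_zero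

/-- Every disjoint sequence in an order interval `[0, w]` is norm null. -/
def OrderBoundedDisjointNull (F : Type*) [NormedAddCommGroup F] [Lattice F] : Prop :=
  ∀ (w : F) (x : ℕ → F), (∀ n, 0 ≤ x n) → (∀ n, x n ≤ w) →
    (Pairwise fun m n => x m ⊓ x n = 0) → Tendsto x atTop (𝓝 0)

theorem PositiveSchur.orderBoundedDisjointNull (h : PositiveSchur F) :
    OrderBoundedDisjointNull F := fun w x hx hw hd => by
  refine h x hx fun f => ?_
  have hA := disjointWeaklyCompact_of_orderBounded (A := Icc 0 w) bddBelow_Icc bddAbove_Icc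
  exact hA.2 x (fun n => ⟨x n, ⟨hx n, hw n⟩, le_rfl⟩) ((disjointSeq_iff_of_nonneg hx).2 hd) f

variable [IsOrderedModule ℝ F]

/-- The jumps of an increasing sequence in `[0, w]` are norm null: cut `[0, w]` by the levels
`j • (δ • w)`; each jump is, up to `δ • w`, a sum of parts straddling the levels, and the parts
straddling a fixed level are disjoint. -/
theorem OrderBoundedDisjointNull.tendsto_sub (h : OrderBoundedDisjointNull F) {w : F} {x : ℕ → F}
    (hx : Monotone x) (h0 : ∀ n, 0 ≤ x n) (hw : ∀ n, x n ≤ w) :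
    Tendsto (fun n => x (n + 1) - x n) atTop (𝓝 0) := by
  have hw0 : 0 ≤ w := (h0 0).trans (hw 0)
  rw [Metric.tendsto_atTop]
  intro ε hε
  obtain ⟨N, hN⟩ := exists_nat_gt (2 * ‖w‖ / ε + 1)
  have hN1 : (1 : ℝ) < N := lt_of_le_of_lt (by
    have : 0 ≤ 2 * ‖w‖ / ε := by positivity
    linarith) hN
  set u : F := (N : ℝ)⁻¹ • w with hu
  have hu0 : 0 ≤ u := smul_nonneg (by positivity) hw0
  have hNu : (N : ℝ) • u = w := by rw [hu, smul_inv_smul₀ (by positivity)]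
  set d : ℕ → ℕ → F := fun j n => (x (n + 1) - (j : ℝ) • u)⁺ ⊓ ((j : ℝ) • u - x n)⁺ with hd
  have hd0 : ∀ j n, 0 ≤ d j n := fun j n => le_inf (posPart_nonneg _) (posPart_nonneg _)
  have hju : ∀ j : ℕ, 0 ≤ (j : ℝ) • u := fun j => smul_nonneg (Nat.cast_nonneg j) hu0
  have hlim : ∀ j, Tendsto (d j) atTop (𝓝 0) := fun j => by
    refine h w (d j) (hd0 j) (fun n => inf_le_left.trans ?_) (pairwise_of_lt_of_inf ?_)
    · rw [posPart_def]
      exact sup_le ((sub_le_self _ (hju j)).trans (hw _)) hw0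
    · intro m n hmn
      refine inf_eq_zero_of_le (c := (x (m + 1) - (j : ℝ) • u)⁺) (d := ((j : ℝ) • u - x n)⁺) ?_
        (hd0 j m) (hd0 j n) inf_le_left inf_le_right
      exact posPart_sub_inf_posPart_sub (hx hmn) le_rfl
  have hsum : Tendsto (fun n => ∑ j ∈ Finset.range N, ‖d j n‖) atTop (𝓝 0) := by
    have := tendsto_finsetSum (Finset.range N) fun j _ => (hlim j).norm
    simpa using this
  have hstep : ∀ n k : ℕ, (x (n + 1) ⊓ (k : ℝ) • u - x n)⁺ ≤ u + ∑ j ∈ Finset.range k, d j n := by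
    intro n k
    induction k with
    | zero =>
      have : (x (n + 1) ⊓ ((0 : ℕ) : ℝ) • u - x n)⁺ = 0 := by
        rw [Nat.cast_zero, zero_smul, inf_eq_right.2 (h0 _), zero_sub]
        exact posPart_eq_zero.2 (neg_nonpos.2 (h0 n))
      rw [this]
      simpa using hu0
    | succ k ih =>
      have h1 := posPart_inf_add_sub_le (x n) (x (n + 1)) ((k : ℝ) • u) u hu0
      rw [Nat.cast_succ, add_smul, one_smul]
      refine h1.trans ?_
      rw [Finset.sum_range_succ, ← add_assoc, add_comm _ (d k n)]
      refine add_le_add le_rfl (sup_le ?_ ih)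
      exact le_add_of_nonneg_right (Finset.sum_nonneg fun j _ => hd0 j n)
  obtain ⟨n₀, hn₀⟩ := (Metric.tendsto_atTop.1 hsum) (ε / 2) (half_pos hε)
  refine ⟨n₀, fun n hn => ?_⟩
  have h1 : x (n + 1) - x n ≤ u + ∑ j ∈ Finset.range N, d j n := by
    refine le_trans ?_ (hstep n N)
    rw [hNu, inf_eq_left.2 (hw _)]
    exact le_posPart _
  have h2 := norm_le_norm_of_nonneg_of_le (sub_nonneg.2 (hx n.le_succ)) h1
  have h3 := hn₀ n hn
  rw [Real.dist_eq, sub_zero] at h3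
  have h4 : ‖u‖ < ε / 2 := by
    rw [hu, norm_smul, norm_inv, RCLike.norm_natCast, inv_mul_lt_iff₀ (by positivity)]
    have h5 : 2 * ‖w‖ / ε < N := by linarith
    rw [div_lt_iff₀ hε] at h5
    linarith
  rw [dist_zero_right]
  calc ‖x (n + 1) - x n‖ ≤ ‖u + ∑ j ∈ Finset.range N, d j n‖ := h2
    _ ≤ ‖u‖ + ∑ j ∈ Finset.range N, ‖d j n‖ :=
      (norm_add_le _ _).trans (add_le_add le_rfl (norm_sum_le _ _))
    _ < ε / 2 + ε / 2 := add_lt_add h4 ((le_abs_self _).trans_lt h3)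
    _ = ε := by ring

theorem OrderBoundedDisjointNull.cauchySeq_of_monotone (h : OrderBoundedDisjointNull F) {w : F}
    {x : ℕ → F} (hx : Monotone x) (h0 : ∀ n, 0 ≤ x n) (hw : ∀ n, x n ≤ w) : CauchySeq x := by
  rw [Metric.cauchySeq_iff']
  by_contra! hcon
  obtain ⟨ε, hε, hcon⟩ := hcon
  choose φ hφ1 hφ2 using hcon
  set N : ℕ → ℕ := fun k => φ^[k] 0 with hN
  have hNs : ∀ k, N (k + 1) = φ (N k) := fun k => Function.iterate_succ_apply' φ k 0
  have hNm : Monotone N := monotone_nat_of_le_succ fun k => by rw [hNs]; exact hφ1 _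
  have hlim := h.tendsto_sub (x := x ∘ N) (hx.comp hNm) (fun n => h0 _) (fun n => hw _)
  obtain ⟨n, hn⟩ := (Metric.tendsto_atTop.1 hlim) ε hε
  have h1 := hn n le_rfl
  rw [dist_zero_right, Function.comp_apply, Function.comp_apply, hNs, ← dist_eq_norm] at h1
  exact absurd h1 (not_lt.2 (hφ2 (N n)))

theorem OrderBoundedDisjointNull.cauchySeq_of_antitone (h : OrderBoundedDisjointNull F) {w : F}
    {x : ℕ → F} (hx : Antitone x) (h0 : ∀ n, 0 ≤ x n) (hw : ∀ n, x n ≤ w) : CauchySeq x := by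
  have h1 := h.cauchySeq_of_monotone (w := w) (x := fun k => w - x k)
    (fun m n hmn => sub_le_sub_left (hx hmn) w) (fun n => sub_nonneg.2 (hw n))
    (fun n => sub_le_self _ (h0 n))
  have h2 := (uniformContinuous_const.sub uniformContinuous_id :
    UniformContinuous fun y : F => w - y).comp_cauchySeq h1
  simpa [Function.comp_def] using h2

variable [CompleteSpace F]

theorem OrderBoundedDisjointNull.orderContinuousNorm (h : OrderBoundedDisjointNull F) :
    OrderContinuousNorm F := by
  intro D hD hdir hglb
  have hD0 : ∀ d ∈ D, 0 ≤ d := fun d hd => hglb.1 hd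
  -- the net is Cauchy, since otherwise a decreasing sequence with large jumps could be extracted
  have hcauchy : ∀ ε > 0, ∀ d₀ ∈ D, ∃ d ∈ D, d ≤ d₀ ∧ ∀ e ∈ D, e ≤ d → ‖d - e‖ ≤ ε := by
    by_contra! hcon
    obtain ⟨ε, hε, d₀, hd₀, hcon⟩ := hcon
    choose! φ hφ1 hφ2 hφ3 using hcon
    set x : ℕ → F := fun k => φ^[k] d₀ with hxdef
    have hxs : ∀ k, x (k + 1) = φ (x k) := fun k => Function.iterate_succ_apply' φ k d₀
    have hxD : ∀ k, x k ∈ D ∧ x k ≤ d₀ := by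
      intro k
      induction k with
      | zero => exact ⟨hd₀, le_rfl⟩
      | succ k ih =>
        rw [hxs]
        exact ⟨hφ1 _ ih.1 ih.2, (hφ2 _ ih.1 ih.2).trans ih.2⟩
    have hxa : Antitone x := antitone_nat_of_succ_le fun k => by
      rw [hxs]
      exact hφ2 _ (hxD k).1 (hxD k).2
    have hlim := h.tendsto_sub (w := d₀) (x := fun k => d₀ - x k)
      (fun m n hmn => sub_le_sub_left (hxa hmn) d₀) (fun n => sub_nonneg.2 (hxD n).2)
      (fun n => sub_le_self _ (hD0 _ (hxD n).1))
    obtain ⟨n, hn⟩ := (Metric.tendsto_atTop.1 hlim) ε hε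
    have h1 := hn n le_rfl
    rw [dist_zero_right, sub_sub_sub_cancel_left, hxs] at h1
    exact absurd h1 (not_lt.2 (hφ3 _ (hxD n).1 (hxD n).2).le)
  choose! ψ hψ1 hψ2 hψ3 using hcauchy
  obtain ⟨d₀, hd₀⟩ := hD
  -- a sequence in `D` approximating the whole net
  let x : ℕ → F := fun n => Nat.rec d₀ (fun n d => ψ ((1 / 2 : ℝ) ^ n) d) n
  have hp : ∀ n : ℕ, (0 : ℝ) < (1 / 2 : ℝ) ^ n := fun n => by positivity
  have hxs : ∀ n, x (n + 1) = ψ ((1 / 2 : ℝ) ^ n) (x n) := fun n => rfl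
  have hxD : ∀ n, x n ∈ D := by
    intro n
    induction n with
    | zero => exact hd₀
    | succ n ih => exact hψ1 _ (hp n) _ ih
  have hxa : Antitone x := antitone_nat_of_succ_le fun n => hψ2 _ (hp n) _ (hxD n)
  have hxc : ∀ n, ∀ e ∈ D, e ≤ x (n + 1) → ‖x (n + 1) - e‖ ≤ (1 / 2 : ℝ) ^ n := fun n =>
    hψ3 _ (hp n) _ (hxD n)
  have hcs : CauchySeq x :=
    h.cauchySeq_of_antitone hxa (fun n => hD0 _ (hxD n)) fun n => hxa (Nat.zero_le n)
  obtain ⟨l, hl⟩ := cauchySeq_tendsto_of_complete hcs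
  have hl1 : Tendsto (fun n => x (n + 1)) atTop (𝓝 l) := (tendsto_add_atTop_iff_nat 1).2 hl
  have hll : ∀ d ∈ D, l ≤ d := by
    intro d hd
    have h1 : Tendsto (fun n => (x (n + 1) - d)⁺) atTop (𝓝 0) := by
      refine squeeze_zero_norm (fun n => ?_)
        (tendsto_pow_atTop_nhds_zero_of_lt_one (r := (1 / 2 : ℝ)) (by norm_num) (by norm_num))
      obtain ⟨e, he, he1, he2⟩ := hdir d hd (x (n + 1)) (hxD (n + 1))
      refine le_trans (norm_le_norm_of_nonneg_of_le (posPart_nonneg _) ?_) (hxc n e he he2)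
      rw [posPart_def]
      exact sup_le (sub_le_sub_left he1 _) (sub_nonneg.2 he2)
    have h2 : Tendsto (fun n => (x (n + 1) - d)⁺ - (x (n + 1) - d)) atTop (𝓝 (0 - (l - d))) :=
      h1.sub (hl1.sub_const d)
    have h3 := ge_of_tendsto h2 (Eventually.of_forall fun n => sub_nonneg.2 (le_posPart _))
    rw [zero_sub, neg_sub] at h3
    exact sub_nonneg.1 h3
  have hl0 : l = 0 := le_antisymm (hglb.2 hll)
    (ge_of_tendsto hl (Eventually.of_forall fun n => hD0 _ (hxD n)))
  rw [hl0] at hl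
  rw [Metric.tendsto_nhds]
  intro ε hε
  obtain ⟨n, hn⟩ := (Metric.tendsto_atTop.1 hl) ε hε
  have : Nonempty D := ⟨⟨d₀, hd₀⟩⟩
  have : IsDirected D (· ≥ ·) := ⟨fun a b => by
    obtain ⟨c, hc, hca, hcb⟩ := hdir a a.2 b b.2
    exact ⟨⟨c, hc⟩, hca, hcb⟩⟩
  refine (eventually_le_atBot (⟨x n, hxD n⟩ : D)).mono fun d hd => ?_
  have h1 := hn n le_rfl
  rw [dist_zero_right] at h1
  rw [Real.dist_eq, sub_zero, abs_norm]
  exact (norm_le_norm_of_nonneg_of_le (hD0 _ d.2) hd).trans_lt h1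

/-- On an order interval the norm is controlled by one positive functional. -/
theorem OrderBoundedDisjointNull.exists_dual_controlling_norm (h : OrderBoundedDisjointNull F)
    {w : F} (hw : 0 ≤ w) {ε : ℝ} (hε : 0 < ε) :
    ∃ g : StrongDual ℝ F, 0 ≤ g ∧ ∃ δ > 0, ∀ z, 0 ≤ z → z ≤ w → g z ≤ δ → ‖z‖ ≤ ε := by
  by_contra! hcon
  choose! Z hZ0 hZw hZg hZn using hcon
  choose ν hν0 hν1 hνn using fun z : F => exists_nonneg_dual_vector z
  let δ : ℕ → ℝ := fun n => (1 / 2 : ℝ) ^ n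
  have hδ : ∀ n, 0 < δ n := fun n => by positivity
  -- `z n` is nearly annihilated by the functionals norming the earlier terms
  let G : ℕ → StrongDual ℝ F := fun n => Nat.rec 0 (fun n g => g + ν (Z g (δ n))) n
  let z : ℕ → F := fun n => Z (G n) (δ n)
  have hGs : ∀ n, G (n + 1) = G n + ν (z n) := fun n => rfl
  have hG0 : ∀ n, 0 ≤ G n := by
    intro n
    induction n with
    | zero => exact le_rfl
    | succ n ih => rw [hGs]; exact add_nonneg ih (hν0 _)
  have hGm : Monotone G := monotone_nat_of_le_succ fun n => by
    rw [hGs]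
    exact le_add_of_nonneg_right (hν0 _)
  have hz0 : ∀ n, 0 ≤ z n := fun n => hZ0 _ (hG0 n) _ (hδ n)
  have hzw : ∀ n, z n ≤ w := fun n => hZw _ (hG0 n) _ (hδ n)
  have hzg : ∀ n, G n (z n) ≤ δ n := fun n => hZg _ (hG0 n) _ (hδ n)
  have hzn : ∀ n, ε < ‖z n‖ := fun n => hZn _ (hG0 n) _ (hδ n)
  have hνz : ∀ k n, k < n → ν (z k) (z n) ≤ δ n := fun k n hkn => by
    have h1 : ν (z k) ≤ G n := by
      refine le_trans ?_ (hGm (Nat.succ_le_of_lt hkn))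
      rw [hGs]
      exact le_add_of_nonneg_left (hG0 k)
    exact (h1 _ (hz0 n)).trans (hzg n)
  -- truncated tails `s n m = (z n + ⋯ + z (m - 1)) ∧ w`, their limits in `m`, and then in `n`
  let s : ℕ → ℕ → F := fun n m => (∑ k ∈ Finset.Ico n m, z k) ⊓ w
  have hs0 : ∀ n m, 0 ≤ s n m := fun n m => le_inf (Finset.sum_nonneg fun k _ => hz0 k) hw
  have hsm : ∀ n, Monotone (s n) := fun n a b hab => inf_le_inf_right _
    (Finset.sum_le_sum_of_subset_of_nonneg (Finset.Ico_subset_Ico_right hab) fun k _ _ => hz0 k)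
  have hsa : ∀ m, Antitone (fun n => s n m) := fun m a b hab => inf_le_inf_right _
    (Finset.sum_le_sum_of_subset_of_nonneg (Finset.Ico_subset_Ico_left hab) fun k _ _ => hz0 k)
  have hsS : ∀ n, ∃ S, Tendsto (s n) atTop (𝓝 S) := fun n =>
    cauchySeq_tendsto_of_complete
      (h.cauchySeq_of_monotone (hsm n) (hs0 n) fun m => inf_le_right)
  choose S hS using hsS
  have hSa : Antitone S := fun a b hab =>
    le_of_tendsto_of_tendsto (hS b) (hS a) (Eventually.of_forall fun m => hsa m hab)
  have hS0 : ∀ n, 0 ≤ S n := fun n => ge_of_tendsto (hS n) (Eventually.of_forall (hs0 n))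
  have hSw : ∀ n, S n ≤ w := fun n => le_of_tendsto (hS n)
    (Eventually.of_forall fun m => inf_le_right)
  have hzS : ∀ n, z n ≤ S n := fun n => by
    refine le_trans ?_ ((hsm n).ge_of_tendsto (hS n) (n + 1))
    exact le_inf (by simp) (hzw n)
  have hScs : CauchySeq S := h.cauchySeq_of_antitone hSa hS0 hSw
  obtain ⟨L, hL⟩ := cauchySeq_tendsto_of_complete hScs
  have hνS : ∀ k n, k < n → ν (z k) (S n) ≤ δ n * 2 := fun k n hkn => by
    refine le_of_tendsto (((ν (z k)).continuous.tendsto _).comp (hS n))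
      (Eventually.of_forall fun m => ?_)
    calc ν (z k) (s n m) ≤ ν (z k) (∑ j ∈ Finset.Ico n m, z j) :=
          dual_apply_mono (hν0 _) inf_le_left
      _ = ∑ j ∈ Finset.Ico n m, ν (z k) (z j) := map_sum _ _ _
      _ ≤ ∑ j ∈ Finset.Ico n m, δ j := Finset.sum_le_sum fun j hj =>
          hνz k j (hkn.trans_le (Finset.mem_Ico.1 hj).1)
      _ ≤ δ n * 2 := by
          rw [Finset.sum_Ico_eq_sum_range]
          simp only [δ, pow_add]
          rw [← Finset.mul_sum]
          refine mul_le_mul_of_nonneg_left ?_ (hδ n).le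
          refine le_of_le_of_eq ?_ tsum_geometric_two
          exact summable_geometric_two.sum_le_tsum _ fun i _ => by positivity
  have hνL : ∀ k, ν (z k) L ≤ 0 := fun k => by
    have h1 : Tendsto (fun n => ν (z k) (S n)) atTop (𝓝 (ν (z k) L)) :=
      ((ν (z k)).continuous.tendsto _).comp hL
    have h2 : Tendsto (fun n => δ n * 2) atTop (𝓝 0) := by
      rw [← zero_mul (2 : ℝ)]
      exact (tendsto_pow_atTop_nhds_zero_of_lt_one (r := (1 / 2 : ℝ)) (by norm_num)
        (by norm_num)).mul_const 2
    exact le_of_tendsto_of_tendsto h1 h2 ((eventually_gt_atTop k).mono fun n hn => hνS k n hn)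
  obtain ⟨n, hn⟩ := (Metric.tendsto_atTop.1 hL) ε hε
  have h1 := hn n le_rfl
  rw [dist_eq_norm] at h1
  have h2 : ε < ν (z n) (z n) := by
    have h3 := hνn (z n)
    rw [abs_of_nonneg (hz0 n)] at h3
    exact (hzn n).trans_le h3
  have h4 : ν (z n) (S n - L) ≤ ‖S n - L‖ := by
    refine (Real.le_norm_self _).trans (((ν (z n)).le_opNorm _).trans ?_)
    exact mul_le_of_le_one_left (norm_nonneg _) (hν1 _)
  rw [map_sub] at h4
  have h5 := dual_apply_mono (hν0 (z n)) (hzS n)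
  have h6 := hνL n
  linarith

end BanachLattice

/-! ### Restriction of a positive functional to a principal band -/

section Restriction

set_option linter.unusedSectionVars false

variable {E : Type*} [NormedAddCommGroup E] [NormedSpace ℝ E] [Lattice E]
  [IsOrderedAddMonoid E] [HasSolidNorm E]

/-- An additive, nonnegative, norm bounded function on the positive cone extends to a functional. -/
theorem exists_dual_eq_on_cone {φ : E → ℝ} {C : ℝ}
    (hadd : ∀ x y, 0 ≤ x → 0 ≤ y → φ (x + y) = φ x + φ y) (h0 : ∀ x, 0 ≤ x → 0 ≤ φ x)
    (hC : ∀ x, 0 ≤ x → φ x ≤ C * ‖x‖) : ∃ h : StrongDual ℝ E, ∀ x, 0 ≤ x → h x = φ x := by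
  have hsub : ∀ a b c d : E, 0 ≤ a → 0 ≤ b → 0 ≤ c → 0 ≤ d → a - b = c - d →
      φ a - φ b = φ c - φ d := fun a b c d ha hb hc hd h => by
    have h2 := congrArg φ (sub_eq_sub_iff_add_eq_add.1 h)
    rw [hadd _ _ ha hd, hadd _ _ hc hb] at h2
    linarith
  have hzero : φ 0 = 0 := by
    have := hadd 0 0 le_rfl le_rfl
    rw [add_zero] at this
    linarith
  let ψ : E →+ ℝ := AddMonoidHom.mk' (fun x : E => φ (x⁺) - φ (x⁻)) (by
    intro x y
    have h := hsub _ _ _ _ (posPart_nonneg (x + y)) (negPart_nonneg (x + y))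
      (add_nonneg (posPart_nonneg x) (posPart_nonneg y))
      (add_nonneg (negPart_nonneg x) (negPart_nonneg y))
      (by rw [posPart_sub_negPart, add_sub_add_comm, posPart_sub_negPart, posPart_sub_negPart])
    rw [hadd _ _ (posPart_nonneg x) (posPart_nonneg y),
      hadd _ _ (negPart_nonneg x) (negPart_nonneg y)] at h
    linarith)
  have hψ : ∀ x, ‖ψ x‖ ≤ |C| * ‖x‖ := fun x => by
    have key : ∀ z : E, 0 ≤ z → z ≤ |x| → φ z ≤ |C| * ‖x‖ := fun z hz hzx => by
      refine (hC z hz).trans ?_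
      refine mul_le_mul (le_abs_self C) ?_ (norm_nonneg _) (abs_nonneg _)
      rw [← norm_abs_eq_norm x]
      exact norm_le_norm_of_nonneg_of_le hz hzx
    have h1 := key _ (posPart_nonneg x) (by
      rw [← posPart_add_negPart x]; exact le_add_of_nonneg_right (negPart_nonneg x))
    have h2 := key _ (negPart_nonneg x) (by
      rw [← posPart_add_negPart x]; exact le_add_of_nonneg_left (posPart_nonneg x))
    have h3 := h0 _ (posPart_nonneg x)
    have h4 := h0 _ (negPart_nonneg x)
    change ‖φ (x⁺) - φ (x⁻)‖ ≤ _
    rw [Real.norm_eq_abs, abs_le]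
    constructor <;> linarith
  refine ⟨AddMonoidHom.toRealLinearMap ψ (AddMonoidHomClass.continuous_of_bound ψ |C| hψ),
    fun x hx => ?_⟩
  change φ (x⁺) - φ (x⁻) = φ x
  rw [posPart_of_nonneg hx, negPart_of_nonneg hx, hzero, sub_zero]

/-- `h` is the restriction of the positive functional `f` to the band generated by `z ≥ 0`, that is,
`h x = lim f (x ⊓ n • z)` for `x ≥ 0`; the band itself is not mentioned, as the band projection need
not exist in `E`. -/
structure IsBandRestriction (f : StrongDual ℝ E) (z : E) (h : StrongDual ℝ E) : Prop where
  nonneg : 0 ≤ h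
  le : h ≤ f
  tendsto : ∀ x, 0 ≤ x → Tendsto (fun n : ℕ => f (x ⊓ n • z)) atTop (𝓝 (h x))

theorem exists_isBandRestriction {f : StrongDual ℝ E} (hf : 0 ≤ f) {z : E} (hz : 0 ≤ z) :
    ∃ h, IsBandRestriction f z h := by
  have hn : ∀ n : ℕ, 0 ≤ n • z := fun n => nsmul_nonneg hz n
  have hmono : ∀ x : E, Monotone fun n : ℕ => f (x ⊓ n • z) := fun x m n hmn =>
    dual_apply_mono hf (inf_le_inf_left x (nsmul_le_nsmul_left hz hmn))
  have hle : ∀ (x : E) (n : ℕ), f (x ⊓ n • z) ≤ f x := fun x n => dual_apply_mono hf inf_le_left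
  set φ : E → ℝ := fun x => ⨆ n : ℕ, f (x ⊓ n • z) with hφ
  have hlim : ∀ x, Tendsto (fun n : ℕ => f (x ⊓ n • z)) atTop (𝓝 (φ x)) := fun x =>
    tendsto_atTop_ciSup (hmono x) ⟨f x, by rintro _ ⟨n, rfl⟩; exact hle x n⟩
  have hφf : ∀ x, φ x ≤ f x := fun x => le_of_tendsto (hlim x) (Eventually.of_forall (hle x))
  have hφ0 : ∀ x, 0 ≤ x → 0 ≤ φ x := fun x hx =>
    ge_of_tendsto (hlim x) (Eventually.of_forall fun n => hf _ (le_inf hx (hn n)))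
  have hadd : ∀ x y, 0 ≤ x → 0 ≤ y → φ (x + y) = φ x + φ y := fun x y hx hy => by
    apply le_antisymm
    · refine le_of_tendsto_of_tendsto (hlim _) ((hlim x).add (hlim y))
        (Eventually.of_forall fun n => ?_)
      change f ((x + y) ⊓ n • z) ≤ f (x ⊓ n • z) + f (y ⊓ n • z)
      rw [← map_add]
      refine dual_apply_mono hf ?_
      rw [inf_comm, inf_comm x, inf_comm y]
      exact inf_add_le_inf_add_inf (hn n) hx hy
    · have h2 : Tendsto (fun n : ℕ => f ((x + y) ⊓ (2 * n) • z)) atTop (𝓝 (φ (x + y))) :=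
        (hlim (x + y)).comp (tendsto_id.const_mul_atTop' two_pos)
      refine le_of_tendsto_of_tendsto ((hlim x).add (hlim y)) h2 (Eventually.of_forall fun n => ?_)
      change f (x ⊓ n • z) + f (y ⊓ n • z) ≤ f ((x + y) ⊓ (2 * n) • z)
      rw [← map_add, two_mul, add_smul]
      exact dual_apply_mono hf (le_inf (add_le_add inf_le_left inf_le_left)
        (add_le_add inf_le_right inf_le_right))
  obtain ⟨h, hh⟩ := exists_dual_eq_on_cone (C := ‖f‖) hadd hφ0 fun x _ =>
    (hφf x).trans ((Real.le_norm_self _).trans (f.le_opNorm x))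
  exact ⟨h, fun x hx => by rw [hh x hx]; exact hφ0 x hx,
    fun x hx => by rw [hh x hx]; exact hφf x, fun x hx => by rw [hh x hx]; exact hlim x⟩

namespace IsBandRestriction

variable {f h : StrongDual ℝ E} {z : E}

theorem apply_self (H : IsBandRestriction f z h) (hz : 0 ≤ z) : h z = f z := by
  refine tendsto_nhds_unique (H.tendsto z hz) (tendsto_const_nhds.congr' ?_)
  filter_upwards [eventually_ge_atTop 1] with n hn
  have : z ≤ n • z := by simpa using nsmul_le_nsmul_left hz hn
  rw [inf_eq_left.2 this]

theorem apply_eq_zero (H : IsBandRestriction f z h) (hz : 0 ≤ z) {x : E} (hx : 0 ≤ x)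
    (hxz : x ⊓ z = 0) : h x = 0 := by
  refine tendsto_nhds_unique (H.tendsto x hx) (tendsto_const_nhds.congr fun n => ?_)
  have h1 : x ⊓ n • z = 0 := by
    have := inf_sum_eq_zero (s := Finset.range n) (b := fun _ => z) hx (fun _ _ => hz)
      fun _ _ => hxz
    simpa using this
  rw [h1, map_zero]

theorem apply_inf_nsmul (H : IsBandRestriction f z h) (hz : 0 ≤ z) {x : E} (hx : 0 ≤ x) (n : ℕ) :
    h (x ⊓ n • z) = f (x ⊓ n • z) := by
  refine tendsto_nhds_unique (H.tendsto _ (le_inf hx (nsmul_nonneg hz n)))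
    (tendsto_const_nhds.congr' ?_)
  filter_upwards [eventually_ge_atTop n] with m hm
  rw [inf_assoc, inf_eq_left.2 (nsmul_le_nsmul_left hz hm)]

/-- Restrictions to disjoint bands are disjoint functionals. -/
theorem inf_eq_zero {f' h' : StrongDual ℝ E} {z' : E} (H : IsBandRestriction f z h)
    (H' : IsBandRestriction f' z' h') (hz : 0 ≤ z) (hz' : 0 ≤ z') (hzz : z ⊓ z' = 0) :
    h ⊓ h' = 0 := by
  refine le_antisymm (fun x hx => ?_) (le_inf H.nonneg H'.nonneg)
  have hn : ∀ n : ℕ, 0 ≤ n • z := fun n => nsmul_nonneg hz n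
  have h1 : ∀ n : ℕ, (h ⊓ h') x ≤ h x - f (x ⊓ n • z) := fun n => by
    have h2 : (h ⊓ h') (x - x ⊓ n • z) ≤ h (x - x ⊓ n • z) :=
      (inf_le_left : h ⊓ h' ≤ h) _ (sub_nonneg.2 inf_le_left)
    have h3 : (h ⊓ h') (x ⊓ n • z) ≤ h' (x ⊓ n • z) :=
      (inf_le_right : h ⊓ h' ≤ h') _ (le_inf hx (hn n))
    have h4 : h' (x ⊓ n • z) = 0 := by
      refine H'.apply_eq_zero hz' (le_inf hx (hn n)) ?_
      refine inf_eq_zero_of_le (c := n • z) (d := z') ?_ (le_inf hx (hn n)) hz' inf_le_right le_rfl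
      have := inf_sum_eq_zero (s := Finset.range n) (b := fun _ => z) hz' (fun _ _ => hz)
        fun _ _ => by rw [inf_comm]; exact hzz
      rw [inf_comm]
      simpa using this
    rw [map_sub, map_sub, H.apply_inf_nsmul hz hx] at h2
    linarith
  have h5 : Tendsto (fun n : ℕ => h x - f (x ⊓ n • z)) atTop (𝓝 (h x - h x)) :=
    (H.tendsto x hx).const_sub _
  rw [sub_self] at h5
  exact ge_of_tendsto h5 (Eventually.of_forall h1)

end IsBandRestriction

/-- The supremum `g |y| = sup {h y : |h| ≤ g}` is attained: take `h` with the sign of `y`. -/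
theorem exists_dual_abs_le_apply_eq {g : StrongDual ℝ E} (hg : 0 ≤ g) (y : E) :
    ∃ h ∈ Icc (-g) g, h y = g |y| := by
  obtain ⟨p, hp⟩ := exists_isBandRestriction hg (posPart_nonneg y)
  obtain ⟨q, hq⟩ := exists_isBandRestriction hg (negPart_nonneg y)
  refine ⟨p - q, ⟨?_, ?_⟩, ?_⟩
  · rw [neg_le_sub_iff_le_add]
    exact hq.le.trans (le_add_of_nonneg_left hp.nonneg)
  · exact (sub_le_self p hq.nonneg).trans hp.le
  · have h1 := hp.apply_self (posPart_nonneg y)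
    have h2 := hq.apply_self (negPart_nonneg y)
    have h3 := hp.apply_eq_zero (posPart_nonneg y) (negPart_nonneg y)
      (by rw [inf_comm]; exact posPart_inf_negPart_eq_zero y)
    have h4 := hq.apply_eq_zero (negPart_nonneg y) (posPart_nonneg y)
      (posPart_inf_negPart_eq_zero y)
    have h5 : (p - q) y = (p - q) (y⁺) - (p - q) (y⁻) := by
      rw [← map_sub, posPart_sub_negPart]
    rw [h5, ← posPart_add_negPart y, map_add, _root_.sub_apply, _root_.sub_apply, h1, h2, h3, h4]
    ring

end Restriction

/-! ### Total boundedness -/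

section TotallyBounded

theorem totallyBounded_of_approx {X : Type*} [PseudoMetricSpace X] {S : Set X}
    (h : ∀ ε > 0, ∃ K : Set X, TotallyBounded K ∧ ∀ x ∈ S, ∃ y ∈ K, dist x y ≤ ε) :
    TotallyBounded S := by
  rw [Metric.totallyBounded_iff]
  intro ε hε
  obtain ⟨K, hK, hSK⟩ := h (ε / 2) (half_pos hε)
  obtain ⟨t, ht, hKt⟩ := Metric.totallyBounded_iff.1 hK (ε / 2) (half_pos hε)
  refine ⟨t, ht, fun x hx => ?_⟩
  obtain ⟨y, hy, hxy⟩ := hSK x hx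
  obtain ⟨z, hz, hyz⟩ := mem_iUnion₂.1 (hKt hy)
  refine mem_iUnion₂.2 ⟨z, hz, ?_⟩
  rw [Metric.mem_ball] at hyz ⊢
  linarith [dist_triangle x y z]

theorem totallyBounded_of_isBounded {X : Type*} [PseudoMetricSpace X] [ProperSpace X] {S : Set X}
    (h : Bornology.IsBounded S) : TotallyBounded S :=
  h.isCompact_closure.totallyBounded.subset subset_closure

theorem isCompact_closure_of_totallyBounded {X : Type*} [PseudoMetricSpace X] [CompleteSpace X]
    {S : Set X} (h : TotallyBounded S) : IsCompact (closure S) :=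
  h.closure.isCompact_of_isClosed isClosed_closure

end TotallyBounded

/-! ### Disjoint weak compactness under the positive Schur property -/

section Schur

set_option linter.unusedSectionVars false

variable {E : Type*} [NormedAddCommGroup E] [NormedSpace ℝ E] [Lattice E]
  [IsOrderedAddMonoid E] [HasSolidNorm E]
  {F : Type*} [NormedAddCommGroup F] [NormedSpace ℝ F] [Lattice F]
  [IsOrderedAddMonoid F] [HasSolidNorm F]

theorem PositiveOperator.mono {S : E →L[ℝ] F} (hS : PositiveOperator S) {x y : E} (h : x ≤ y) :
    S x ≤ S y := by
  have := hS (y - x) (sub_nonneg.2 h)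
  rw [map_sub] at this
  exact sub_nonneg.1 this

theorem PositiveOperator.abs_apply_le {S : E →L[ℝ] F} (hS : PositiveOperator S) (x : E) :
    |S x| ≤ S |x| := by
  refine abs_le'.2 ⟨hS.mono (le_abs_self x), ?_⟩
  rw [← map_neg]
  exact hS.mono (neg_le_abs x)

/-- If the adjoint maps the order interval `[-g, g]` to a totally bounded set, then the operator
maps order intervals to sets that are totally bounded for the seminorm `y ↦ g |y|`. -/
theorem exists_finite_net_of_totallyBounded_adjoint (T : E →L[ℝ] F) {g : StrongDual ℝ F}
    (hg : 0 ≤ g) (hT : TotallyBounded (adjointOperator T '' Icc (-g) g)) {A : Set E}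
    (hA : Bornology.IsBounded A) {δ : ℝ} (hδ : 0 < δ) :
    ∃ t : Set E, t.Finite ∧ t ⊆ A ∧ ∀ x ∈ A, ∃ y ∈ t, g |T x - T y| ≤ δ := by
  obtain ⟨C, hC0, hC⟩ := hA.exists_pos_norm_le
  have hη : 0 < δ / (4 * C) := by positivity
  obtain ⟨N, hN, hTN⟩ := Metric.totallyBounded_iff.1 hT _ hη
  have : Fintype N := hN.fintype
  -- the finitely many functionals of a net of `T* [-g, g]` embed `A` into a finite power of `ℝ`
  let Φ : E →L[ℝ] (N → ℝ) := ContinuousLinearMap.pi fun ψ => (ψ : StrongDual ℝ E)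
  have hΦ : TotallyBounded (Φ '' A) :=
    totallyBounded_of_isBounded (Φ.lipschitz.isBounded_image hA)
  obtain ⟨t, htA, ht, hAs⟩ := exists_subset_image_finite_and.1
    (Metric.finite_approx_of_totallyBounded hΦ (δ / 2) (half_pos hδ))
  refine ⟨t, ht, htA, fun x hx => ?_⟩
  obtain ⟨_, ⟨y, hy, rfl⟩, hxy⟩ := mem_iUnion₂.1 (hAs (mem_image_of_mem Φ hx))
  refine ⟨y, hy, ?_⟩
  obtain ⟨h, hh, hhy⟩ := exists_dual_abs_le_apply_eq hg (T x - T y)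
  obtain ⟨ψ, hψ, hhψ⟩ := mem_iUnion₂.1 (hTN (mem_image_of_mem _ hh))
  rw [Metric.mem_ball, dist_eq_norm] at hhψ
  rw [Metric.mem_ball] at hxy
  have h1 : |ψ x - ψ y| ≤ δ / 2 := (dist_le_pi_dist (Φ x) (Φ y) ⟨ψ, hψ⟩).trans hxy.le
  have h2 : ‖(adjointOperator T h - ψ) (x - y)‖ ≤ δ / (4 * C) * (C + C) :=
    ((adjointOperator T h - ψ).le_opNorm _).trans (mul_le_mul hhψ.le
      ((norm_sub_le x y).trans (add_le_add (hC x hx) (hC y (htA hy)))) (norm_nonneg _) hη.le)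
  have h3 : δ / (4 * C) * (C + C) = δ / 2 := by field_simp; ring
  have h4 : h (T x - T y) = (adjointOperator T h - ψ) (x - y) + (ψ x - ψ y) := by
    have : adjointOperator T h (x - y) = h (T x - T y) := by
      rw [← map_sub]
      rfl
    rw [_root_.sub_apply, this, map_sub ψ]
    ring
  rw [← hhy, h4]
  rw [h3] at h2
  linarith [(Real.le_norm_self _).trans h2, (le_abs_self _).trans h1]

variable [IsOrderedModule ℝ E]

/-- A positive operator that sends the disjoint positive sequences of the solid hull of a bounded
set `A` to null sequences is small on the parts `(|x| - u)⁺` of the elements of `A` above a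
suitable level `u`. -/
theorem exists_norm_apply_posPart_le [CompleteSpace E] {S : E →L[ℝ] F} (hS : PositiveOperator S)
    {A : Set E} (hA : Bornology.IsBounded A)
    (hnull : ∀ x : ℕ → E, (∀ n, 0 ≤ x n) →
      (∀ n, x n ∈ LatticeOrderedAddCommGroup.solidClosure A) →
      (Pairwise fun m n => x m ⊓ x n = 0) → Tendsto (fun n => S (x n)) atTop (𝓝 0))
    {ε : ℝ} (hε : 0 < ε) : ∃ u, 0 ≤ u ∧ ∀ x ∈ A, ‖S ((|x| - u)⁺)‖ ≤ ε := by
  by_contra! hcon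
  choose! X hXA hXε using hcon
  obtain ⟨C, hC0, hC⟩ := hA.exists_pos_norm_le
  -- `σ n` is the sum of the first `n` terms of the sequence `x`
  let σ : ℕ → E := fun n => Nat.rec 0 (fun n s => s + |X ((4 : ℝ) ^ n • s)|) n
  let x : ℕ → E := fun n => |X ((4 : ℝ) ^ n • σ n)|
  have hσs : ∀ n, σ (n + 1) = σ n + x n := fun n => rfl
  have hx0 : ∀ n, 0 ≤ x n := fun n => abs_nonneg _
  have hσ0 : ∀ n, 0 ≤ σ n := by
    intro n
    induction n with
    | zero => exact le_rfl
    | succ n ih => rw [hσs]; exact add_nonneg ih (hx0 n)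
  have h4σ : ∀ n, 0 ≤ (4 : ℝ) ^ n • σ n := fun n => smul_nonneg (by positivity) (hσ0 n)
  have hXA' : ∀ n, X ((4 : ℝ) ^ n • σ n) ∈ A := fun n => hXA _ (h4σ n)
  have hσm : Monotone σ := monotone_nat_of_le_succ fun n => by
    rw [hσs]; exact le_add_of_nonneg_right (hx0 n)
  have hxσ : ∀ m n, m < n → x m ≤ σ n := fun m n hmn => by
    refine le_trans ?_ (hσm (Nat.succ_le_of_lt hmn))
    rw [hσs]
    exact le_add_of_nonneg_left (hσ0 m)
  have hsum : Summable fun n => (1 / 2 : ℝ) ^ n • x n := by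
    refine Summable.of_norm_bounded (summable_geometric_two.mul_right C) fun n => ?_
    rw [norm_smul, norm_pow, Real.norm_of_nonneg (by norm_num : (0 : ℝ) ≤ 1 / 2)]
    refine mul_le_mul_of_nonneg_left ?_ (by positivity)
    rw [norm_abs_eq_norm]
    exact hC _ (hXA' n)
  set y : E := ∑' n, (1 / 2 : ℝ) ^ n • x n with hy
  have hterm0 : ∀ n, 0 ≤ (1 / 2 : ℝ) ^ n • x n := fun n => smul_nonneg (by positivity) (hx0 n)
  have hxy : ∀ n, (1 / 2 : ℝ) ^ n • x n ≤ y := fun n => hsum.le_tsum n fun j _ => hterm0 j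
  have hy0 : 0 ≤ y := (hterm0 0).trans (hxy 0)
  have hpy : ∀ n, 0 ≤ (1 / 2 : ℝ) ^ n • y := fun n => smul_nonneg (by positivity) hy0
  let v : ℕ → E := fun n => (x n - ((4 : ℝ) ^ n • σ n + (1 / 2 : ℝ) ^ n • y))⁺
  have hvx : ∀ n, v n ≤ x n := fun n => by
    change (x n - _)⁺ ≤ x n
    rw [posPart_def]
    exact sup_le (sub_le_self _ (add_nonneg (h4σ n) (hpy n))) (hx0 n)
  have hvd : Pairwise fun m n => v m ⊓ v n = 0 := by
    refine pairwise_of_lt_of_inf fun m n hmn => ?_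
    have h1 : v n ≤ (x n - (4 : ℝ) ^ n • x m)⁺ := by
      refine posPart_sub_le_posPart_sub le_rfl (le_add_of_le_of_nonneg ?_ (hpy n))
      exact smul_le_smul_of_nonneg_left (hxσ m n hmn) (by positivity)
    have h2 : v m ≤ (x m - ((1 / 2 : ℝ) ^ m * (1 / 2 : ℝ) ^ n) • x n)⁺ := by
      refine posPart_sub_le_posPart_sub le_rfl (le_add_of_nonneg_of_le (h4σ m) ?_)
      rw [mul_smul]
      exact smul_le_smul_of_nonneg_left (hxy n) (by positivity)
    have h3 : (1 : ℝ) ≤ 4 ^ n * ((1 / 2) ^ m * (1 / 2) ^ n) := by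
      have h5 : (1 / 2 : ℝ) ^ n ≤ (1 / 2) ^ m :=
        pow_le_pow_of_le_one (by norm_num) (by norm_num) hmn.le
      calc (1 : ℝ) = 4 ^ n * ((1 / 2) ^ n * (1 / 2) ^ n) := by
            rw [← mul_pow, ← mul_pow]; norm_num
        _ ≤ _ := by gcongr
    rw [inf_comm]
    exact inf_eq_zero_of_le
      (posPart_sub_smul_inf_posPart_sub_smul (by positivity) h3 (hx0 n))
      (posPart_nonneg _) (posPart_nonneg _) h1 h2
  have hSv := hnull v (fun n => posPart_nonneg _) (fun n => ⟨_, hXA' n, by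
    rw [abs_of_nonneg (posPart_nonneg _ : 0 ≤ v n)]
    exact hvx n⟩) hvd
  have hlim : Tendsto (fun n => ‖S (v n)‖ + (1 / 2 : ℝ) ^ n * ‖S y‖) atTop (𝓝 0) := by
    have h1 := (tendsto_pow_atTop_nhds_zero_of_lt_one (r := (1 / 2 : ℝ)) (by norm_num)
        (by norm_num)).mul_const ‖S y‖
    simpa only [norm_zero, zero_mul, add_zero] using hSv.norm.add h1
  obtain ⟨n, hn⟩ := (hlim.eventually (gt_mem_nhds hε)).exists
  have h1 : (x n - (4 : ℝ) ^ n • σ n)⁺ ≤ v n + (1 / 2 : ℝ) ^ n • y := by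
    rw [posPart_def]
    refine sup_le ?_ (add_nonneg (posPart_nonneg _) (hpy n))
    rw [← sub_le_iff_le_add, sub_sub]
    exact le_posPart _
  have h2 := norm_le_norm_of_nonneg_of_le (hS _ (posPart_nonneg _)) (hS.mono h1)
  rw [map_add, map_smul] at h2
  have h3 : ‖S (v n) + (1 / 2 : ℝ) ^ n • S y‖ ≤ ‖S (v n)‖ + (1 / 2 : ℝ) ^ n * ‖S y‖ := by
    refine (norm_add_le _ _).trans (le_of_eq ?_)
    rw [norm_smul, norm_pow, Real.norm_of_nonneg (by norm_num : (0 : ℝ) ≤ 1 / 2)]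
  have h4 : ε < ‖S ((x n - (4 : ℝ) ^ n • σ n)⁺)‖ := hXε _ (h4σ n)
  linarith

/-- The truncation of `x` to `[-u, u]` differs from `x` by at most `(|x| - u)⁺`. -/
theorem exists_mem_Icc_abs_sub_le {u : E} (hu : 0 ≤ u) (x : E) :
    ∃ y ∈ Icc (-u) u, |x - y| ≤ (|x| - u)⁺ := by
  refine ⟨x ⊓ u ⊔ -u, ⟨le_sup_right, sup_le inf_le_right (neg_le_self hu)⟩, abs_le'.2 ⟨?_, ?_⟩⟩
  · rw [sub_le_comm]
    refine le_trans ?_ le_sup_left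
    refine le_inf (sub_le_self _ (posPart_nonneg _)) ?_
    rw [sub_le_comm]
    exact (sub_le_sub_right (le_abs_self x) u).trans (le_posPart _)
  · rw [neg_sub, sub_le_iff_le_add]
    refine sup_le (inf_le_left.trans (le_add_of_nonneg_left (posPart_nonneg _))) ?_
    rw [← sub_le_iff_le_add, show -u - x = -x - u by abel]
    exact (sub_le_sub_right (neg_le_abs x) u).trans (le_posPart _)

theorem dwCompact_of_positiveSchur [CompleteSpace E] [CompleteSpace F] [IsOrderedModule ℝ F]
    (hF : PositiveSchur F)
    {T : E →L[ℝ] F} (hT : RegularOperator T) (hT' : AMCompact (adjointOperator T)) :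
    DWCompact T := by
  intro A hA
  obtain ⟨S₁, S₂, hS₁, hS₂, rfl⟩ := hT
  set T := S₁ - S₂ with hTdef
  set S := S₁ + S₂ with hSdef
  have hS : PositiveOperator S := fun x hx => add_nonneg (hS₁ x hx) (hS₂ x hx)
  have hTS : ∀ x, |T x| ≤ S |x| := fun x => by
    have h1 : |S₁ x - S₂ x| ≤ |S₁ x| + |S₂ x| := by
      rw [sub_eq_add_neg, ← abs_neg (S₂ x)]
      exact abs_add_le _ _
    exact h1.trans (add_le_add (hS₁.abs_apply_le x) (hS₂.abs_apply_le x))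
  -- order intervals are mapped to totally bounded sets
  have hIcc : ∀ u : E, 0 ≤ u → TotallyBounded (T '' Icc (-u) u) := fun u hu => by
    rw [Metric.totallyBounded_iff]
    intro ε hε
    have hw : 0 ≤ S u + S u := add_nonneg (hS u hu) (hS u hu)
    obtain ⟨g, hg, δ, hδ, hgδ⟩ :=
      hF.orderBoundedDisjointNull.exists_dual_controlling_norm hw (half_pos hε)
    have hb : Bornology.IsBounded (Icc (-u) u) :=
      (disjointWeaklyCompact_of_orderBounded bddBelow_Icc bddAbove_Icc).1
    obtain ⟨t, ht, htA, hnet⟩ := exists_finite_net_of_totallyBounded_adjoint T hg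
      ((hT' (Icc (-g) g) bddBelow_Icc bddAbove_Icc).totallyBounded.subset subset_closure) hb hδ
    have hTu : ∀ x ∈ Icc (-u) u, |T x| ≤ S u := fun x hx =>
      (hTS x).trans (hS.mono (abs_le'.2 ⟨hx.2, neg_le.1 hx.1⟩))
    refine ⟨T '' t, ht.image T, ?_⟩
    rintro _ ⟨x, hx, rfl⟩
    obtain ⟨y, hy, hxy⟩ := hnet x hx
    refine mem_iUnion₂.2 ⟨T y, mem_image_of_mem T hy, ?_⟩
    have h1 : |T x - T y| ≤ S u + S u := by
      rw [sub_eq_add_neg]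
      refine (abs_add_le _ _).trans ?_
      rw [abs_neg]
      exact add_le_add (hTu x hx) (hTu y (htA hy))
    have h2 := hgδ _ (abs_nonneg _) h1 hxy
    rw [norm_abs_eq_norm] at h2
    rw [Metric.mem_ball, dist_eq_norm]
    linarith
  refine isCompact_closure_of_totallyBounded (totallyBounded_of_approx fun ε hε => ?_)
  obtain ⟨u, hu, huA⟩ := exists_norm_apply_posPart_le hS hA.1 (fun x hx hxA hd => by
    refine hF _ (fun n => hS _ (hx n)) fun f => ?_
    exact hA.2 x hxA ((disjointSeq_iff_of_nonneg hx).2 hd) (f.comp S)) hε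
  refine ⟨T '' Icc (-u) u, hIcc u hu, ?_⟩
  rintro _ ⟨x, hx, rfl⟩
  obtain ⟨y, hy, hxy⟩ := exists_mem_Icc_abs_sub_le hu x
  refine ⟨T y, mem_image_of_mem T hy, ?_⟩
  rw [dist_eq_norm, ← map_sub]
  exact (norm_le_norm_of_abs_le ((hTS _).trans (hS.mono hxy))).trans (huA x hx)

end Schur

/-! ### Rademacher sequences below a functional without atoms -/

section Rademacher

set_option linter.unusedSectionVars false

variable {E : Type*} [NormedAddCommGroup E] [NormedSpace ℝ E] [Lattice E]
  [IsOrderedAddMonoid E] [HasSolidNorm E]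

/-- A positive vector that is not discrete dominates, in modulus, a nonzero vector on which a given
linear form vanishes. -/
theorem exists_ne_zero_abs_le_map_eq_zero {G : Type*} [NormedAddCommGroup G] [NormedSpace ℝ G]
    [Lattice G] [IsOrderedAddMonoid G] [IsOrderedModule ℝ G] {g : G} (hg : 0 < g)
    (hd : ¬ DiscreteVector g) (l : G →ₗ[ℝ] ℝ) : ∃ w, w ≠ 0 ∧ |w| ≤ g ∧ l w = 0 := by
  by_cases hgl : l g = 0
  · exact ⟨g, hg.ne', (abs_of_pos hg).le, hgl⟩
  have hd' : ∃ v : G, |v| ≤ g ∧ ∀ c : ℝ, v ≠ c • g := by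
    by_contra! hcon
    exact hd ⟨hg, hcon⟩
  obtain ⟨v, hvg, hv⟩ := hd'
  set M : ℝ := |l g| + |l v| with hM
  have hM0 : 0 < M := add_pos_of_pos_of_nonneg (abs_pos.2 hgl) (abs_nonneg _)
  refine ⟨M⁻¹ • (l g • v - l v • g), ?_, ?_, ?_⟩
  · refine smul_ne_zero (inv_ne_zero hM0.ne') fun h0 => hv ((l g)⁻¹ * l v) ?_
    rw [mul_smul, ← sub_eq_zero.1 h0, inv_smul_smul₀ hgl]
  · rw [abs_smul_of_nonneg (inv_nonneg.2 hM0.le)]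
    have h1 : |l g • v - l v • g| ≤ M • g := by
      rw [sub_eq_add_neg, hM, add_smul]
      refine (abs_add_le _ _).trans (add_le_add ((abs_smul_le _ _).trans ?_) ?_)
      · exact smul_le_smul_of_nonneg_left hvg (abs_nonneg _)
      · rw [abs_neg]
        refine (abs_smul_le _ _).trans (le_of_eq ?_)
        rw [abs_of_pos hg]
    calc M⁻¹ • |l g • v - l v • g| ≤ M⁻¹ • M • g :=
          smul_le_smul_of_nonneg_left h1 (inv_nonneg.2 hM0.le)
      _ = g := inv_smul_smul₀ hM0.ne' g
  · simp only [map_smul, map_sub, smul_eq_mul]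
    ring

/-- A functional `a` without atoms has a component `b` that halves the value at a given vector.
Any extreme point of the weak-star compact convex set `{h ∈ [0, a] | h x₀ = a x₀ / 2}` is such a
component: otherwise `h ⊓ (a - h) > 0` is not discrete and leaves room to perturb `h` in two
opposite directions. -/
theorem exists_component_halving {a : StrongDual ℝ E} (ha : 0 ≤ a)
    (hatom : ∀ u : StrongDual ℝ E, DiscreteVector u → ¬ u ≤ a) (x₀ : E) :
    ∃ b : StrongDual ℝ E, 0 ≤ b ∧ b ≤ a ∧ b ⊓ (a - b) = 0 ∧ b x₀ = a x₀ / 2 := by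
  have : LocallyConvexSpace ℝ (WeakDual ℝ E) :=
    (inferInstance : LocallyConvexSpace ℝ (WeakBilin (topDualPairing ℝ E)))
  let K : Set (WeakDual ℝ E) :=
    {h | WeakDual.toStrongDual h ∈ Icc 0 a ∧ WeakDual.toStrongDual h x₀ = a x₀ / 2}
  have hev : ∀ x : E, Continuous fun h : WeakDual ℝ E => WeakDual.toStrongDual h x :=
    fun x => WeakDual.eval_continuous x
  have hKclosed : IsClosed K := by
    have h1 : K = (⋂ x : E, ⋂ _ : 0 ≤ x, {h | 0 ≤ WeakDual.toStrongDual h x}) ∩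
        (⋂ x : E, ⋂ _ : 0 ≤ x, {h | WeakDual.toStrongDual h x ≤ a x}) ∩
        {h | WeakDual.toStrongDual h x₀ = a x₀ / 2} := by
      ext h
      simp only [K, mem_ofPred_eq, mem_inter_iff, mem_iInter, mem_Icc, dual_le_iff]
      rfl
    rw [h1]
    refine IsClosed.inter (IsClosed.inter ?_ ?_) (isClosed_eq (hev x₀) continuous_const)
    · exact isClosed_iInter fun x => isClosed_iInter fun _ =>
        isClosed_le continuous_const (hev x)
    · exact isClosed_iInter fun x => isClosed_iInter fun _ =>
        isClosed_le (hev x) continuous_const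
  have hKcompact : IsCompact K := by
    refine (WeakDual.isCompact_closedBall (𝕜 := ℝ) (E := E) 0 ‖a‖).of_isClosed_subset hKclosed
      fun h hh => ?_
    rw [mem_preimage, mem_closedBall_zero_iff]
    exact norm_le_norm_of_nonneg_of_le hh.1.1 hh.1.2
  have hKne : K.Nonempty := by
    have h1 : (1 / 2 : ℝ) • a + (1 / 2 : ℝ) • a = a := by
      rw [← add_smul]; norm_num
    have h2 : 0 ≤ (1 / 2 : ℝ) • a := smul_nonneg (by norm_num) ha
    refine ⟨StrongDual.toWeakDual ((1 / 2 : ℝ) • a), ⟨h2, ?_⟩, ?_⟩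
    · exact (le_add_of_nonneg_left h2).trans h1.le
    · change (1 / 2 : ℝ) * a x₀ = a x₀ / 2
      ring
  obtain ⟨h, hK, hext⟩ := hKcompact.extremePoints_nonempty hKne
  set b : StrongDual ℝ E := WeakDual.toStrongDual h with hb
  refine ⟨b, hK.1.1, hK.1.2, ?_, hK.2⟩
  by_contra hne
  have hg0 : 0 ≤ b ⊓ (a - b) := le_inf hK.1.1 (sub_nonneg.2 hK.1.2)
  have hg : 0 < b ⊓ (a - b) := lt_of_le_of_ne hg0 (Ne.symm hne)
  obtain ⟨w, hw0, hwg, hwx⟩ := exists_ne_zero_abs_le_map_eq_zero hg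
    (fun hd => hatom _ hd (inf_le_left.trans hK.1.2))
    ((ContinuousLinearMap.apply ℝ ℝ x₀).toLinearMap : StrongDual ℝ E →ₗ[ℝ] ℝ)
  have hwx' : w x₀ = 0 := hwx
  have key : ∀ w' : StrongDual ℝ E, |w'| ≤ b ⊓ (a - b) → w' x₀ = 0 →
      StrongDual.toWeakDual (b + w') ∈ K := fun w' h1 h2 => by
    refine ⟨⟨?_, ?_⟩, ?_⟩
    · change 0 ≤ b + w'
      rw [← neg_le_iff_add_nonneg']
      exact neg_le.1 ((neg_le_abs w').trans (h1.trans inf_le_left))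
    · change b + w' ≤ a
      rw [← le_sub_iff_add_le']
      exact (le_abs_self w').trans (h1.trans inf_le_right)
    · change b x₀ + w' x₀ = a x₀ / 2
      rw [h2, add_zero]
      exact hK.2
  have h1 := key w hwg hwx'
  have h2 := key (-w) (by rwa [abs_neg]) (by
    rw [_root_.neg_apply, hwx', neg_zero])
  have h3 := hext h1 h2 ⟨1 / 2, 1 / 2, by norm_num, by norm_num, by norm_num, by
    rw [← map_smul, ← map_smul, ← map_add, ← smul_add]
    have : (1 / 2 : ℝ) • (b + w + (b + -w)) = b := by
      rw [add_add_add_comm, add_neg_cancel, add_zero, ← two_smul ℝ b, smul_smul]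
      norm_num
    rw [this]
    rfl⟩
  have h4 : b + w = b := StrongDual.toWeakDual.injective h3
  exact hw0 (add_eq_left.1 h4)

theorem sum_range_two_mul {M : Type*} [AddCommMonoid M] (φ : ℕ → M) (m : ℕ) :
    ∑ k ∈ Finset.range (2 * m), φ k = ∑ k ∈ Finset.range m, (φ (2 * k) + φ (2 * k + 1)) := by
  induction m with
  | zero => simp
  | succ m ih =>
    rw [mul_add, mul_one, Finset.sum_range_succ, Finset.sum_range_succ, ih,
      Finset.sum_range_succ, add_assoc]

/-- A tree of components of `f`, given by a rule `B` that splits a component `a` as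
`B a + (a - B a)`; the components of generation `n` are numbered by `k < 2 ^ n`. -/
noncomputable def splittingTree {G : Type*} [AddCommGroup G] (B : G → G) (f : G) : ℕ → ℕ → G
  | 0, k => if k = 0 then f else 0
  | n + 1, k =>
    if k % 2 = 0 then B (splittingTree B f n (k / 2))
    else splittingTree B f n (k / 2) - B (splittingTree B f n (k / 2))

section Tree

variable {G : Type*} [AddCommGroup G] (B : G → G) (f : G)

theorem splittingTree_succ_two_mul (n k : ℕ) :
    splittingTree B f (n + 1) (2 * k) = B (splittingTree B f n k) := by
  simp [splittingTree]

theorem splittingTree_succ_two_mul_add_one (n k : ℕ) :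
    splittingTree B f (n + 1) (2 * k + 1) =
      splittingTree B f n k - B (splittingTree B f n k) := by
  have h1 : (2 * k + 1) % 2 = 1 := by omega
  have h2 : (2 * k + 1) / 2 = k := by omega
  simp [splittingTree, h1, h2]

theorem sum_splittingTree (n : ℕ) : ∑ k ∈ Finset.range (2 ^ n), splittingTree B f n k = f := by
  induction n with
  | zero => simp [splittingTree]
  | succ n ih =>
    rw [pow_succ', sum_range_two_mul]
    simpa only [splittingTree_succ_two_mul, splittingTree_succ_two_mul_add_one,
      add_sub_cancel] using ih

variable {B f} [Lattice G] [IsOrderedAddMonoid G]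

theorem splittingTree_mem_Icc (hf : 0 ≤ f) (hB : ∀ a ∈ Icc 0 f, B a ∈ Icc 0 a) (n k : ℕ) :
    splittingTree B f n k ∈ Icc 0 f := by
  induction n generalizing k with
  | zero =>
    simp only [splittingTree]
    split_ifs
    · exact ⟨hf, le_rfl⟩
    · exact ⟨le_rfl, hf⟩
  | succ n ih =>
    have h1 := ih (k / 2)
    have h2 := hB _ h1
    simp only [splittingTree]
    split_ifs
    · exact ⟨h2.1, h2.2.trans h1.2⟩
    · exact ⟨sub_nonneg.2 h2.2, (sub_le_self _ h2.1).trans h1.2⟩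

theorem splittingTree_inf_eq_zero (hf : 0 ≤ f) (hB : ∀ a ∈ Icc 0 f, B a ∈ Icc 0 a)
    (hd : ∀ a ∈ Icc 0 f, B a ⊓ (a - B a) = 0) (n : ℕ) :
    Pairwise fun k l => splittingTree B f n k ⊓ splittingTree B f n l = 0 := by
  induction n with
  | zero =>
    intro k l hkl
    simp only [splittingTree]
    split_ifs with h1 h2 h2
    · exact absurd (h1.trans h2.symm) hkl
    · exact inf_eq_right.2 hf
    · exact inf_eq_left.2 hf
    · exact inf_idem 0
  | succ n ih =>
    have hle : ∀ k, splittingTree B f (n + 1) k ≤ splittingTree B f n (k / 2) := fun k => by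
      have h2 := hB _ (splittingTree_mem_Icc hf hB n (k / 2))
      simp only [splittingTree]
      split_ifs
      · exact h2.2
      · exact sub_le_self _ h2.1
    intro k l hkl
    rcases eq_or_ne (k / 2) (l / 2) with h | h
    · have h3 := hd _ (splittingTree_mem_Icc hf hB n (l / 2))
      simp only [splittingTree, h]
      split_ifs with h1 h2 h2
      · omega
      · exact h3
      · rw [inf_comm]
        exact h3
      · omega
    · exact inf_eq_zero_of_le (ih h) (splittingTree_mem_Icc hf hB _ _).1
        (splittingTree_mem_Icc hf hB _ _).1 (hle k) (hle l)

end Tree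

/-- If the dual is not discrete, it contains a weak-star null sequence of functionals with a common
nonzero modulus. -/
theorem exists_rademacher (hE : ¬ DiscreteLattice (StrongDual ℝ E)) :
    ∃ (f : StrongDual ℝ E) (x₀ : E) (r : ℕ → StrongDual ℝ E), 0 ≤ x₀ ∧ 0 < f x₀ ∧
      (∀ n, |r n| = f) ∧ ∀ x, Tendsto (fun n => r n x) atTop (𝓝 0) := by
  have hE' : ∃ f₀ : StrongDual ℝ E, 0 < f₀ ∧ ∀ u, DiscreteVector u → ¬ u ≤ f₀ := by
    by_contra! hcon
    exact hE hcon
  obtain ⟨f₀, hf₀, hatom⟩ := hE'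
  have hx₀ : ∃ x₀ : E, 0 ≤ x₀ ∧ 0 < f₀ x₀ := by
    by_contra! hcon
    exact hf₀.not_ge fun x hx => hcon x hx
  obtain ⟨x₀, hx₀, hfx₀⟩ := hx₀
  -- on the band of `x₀`, the functional is determined by the multiples of `x₀`
  obtain ⟨f, hf⟩ := exists_isBandRestriction hf₀.le hx₀
  have hf0 := hf.nonneg
  have hfx : f x₀ = f₀ x₀ := hf.apply_self hx₀
  have hhalf : ∀ a ∈ Icc 0 f, ∃ b : StrongDual ℝ E, 0 ≤ b ∧ b ≤ a ∧ b ⊓ (a - b) = 0 ∧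
      b x₀ = a x₀ / 2 := fun a ha => exists_component_halving ha.1
    (fun u hu hua => hatom u hu (hua.trans (ha.2.trans hf.le))) x₀
  choose! B hB0 hBa hBd hBx using hhalf
  have hBI : ∀ a ∈ Icc 0 f, B a ∈ Icc 0 a := fun a ha => ⟨hB0 a ha, hBa a ha⟩
  let a : ℕ → ℕ → StrongDual ℝ E := splittingTree B f
  have haI : ∀ n k, a n k ∈ Icc 0 f := splittingTree_mem_Icc hf0 hBI
  have had : ∀ n, Pairwise fun k l => a n k ⊓ a n l = 0 :=
    splittingTree_inf_eq_zero hf0 hBI hBd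
  have hasum : ∀ n, ∑ k ∈ Finset.range (2 ^ n), a n k = f := sum_splittingTree B f
  have hax : ∀ n k, a n k x₀ ≤ f x₀ / 2 ^ n := by
    intro n
    induction n with
    | zero =>
      intro k
      rw [pow_zero, div_one]
      exact (haI 0 k).2 x₀ hx₀
    | succ n ih =>
      intro k
      have h1 : a (n + 1) k x₀ = a n (k / 2) x₀ / 2 := by
        have h2 := hBx _ (haI n (k / 2))
        change (splittingTree B f (n + 1) k) x₀ = _
        simp only [splittingTree]
        split_ifs
        · exact h2
        · rw [_root_.sub_apply]
          change a n (k / 2) x₀ - B (a n (k / 2)) x₀ = _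
          rw [h2]
          ring
      rw [h1, pow_succ, ← div_div]
      linarith [ih (k / 2)]
  let d : ℕ → ℕ → StrongDual ℝ E := fun n k => B (a n k) - (a n k - B (a n k))
  let r : ℕ → StrongDual ℝ E := fun n => ∑ k ∈ Finset.range (2 ^ n), d n k
  have hr : ∀ n, |r n| = f := fun n => by
    have h1 : (∑ k ∈ Finset.range (2 ^ n), B (a n k)) ⊓
        ∑ l ∈ Finset.range (2 ^ n), (a n l - B (a n l)) = 0 := by
      refine sum_inf_sum_eq_zero (fun k _ => hB0 _ (haI n k))
        (fun l _ => sub_nonneg.2 (hBa _ (haI n l))) fun k _ l _ => ?_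
      rcases eq_or_ne k l with rfl | hkl
      · exact hBd _ (haI n k)
      · exact inf_eq_zero_of_le (had n hkl) (hB0 _ (haI n k))
          (sub_nonneg.2 (hBa _ (haI n l))) (hBa _ (haI n k)) (sub_le_self _ (hB0 _ (haI n l)))
    change |∑ k ∈ Finset.range (2 ^ n), (B (a n k) - (a n k - B (a n k)))| = f
    rw [Finset.sum_sub_distrib, abs_sub_eq_add_of_inf_eq_zero h1, ← Finset.sum_add_distrib]
    simpa only [add_sub_cancel] using hasum n
  -- Bessel's inequality: up to the factor `f x₀`, `Q n x` is the squared length of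
  -- the conditional expectation of `x` on the `n`-th generation of the tree
  let Q : ℕ → E → ℝ := fun n x => 2 ^ n * ∑ k ∈ Finset.range (2 ^ n), (a n k x) ^ 2
  have hQ : ∀ n x, (r n x) ^ 2 ≤ Q (n + 1) x - Q n x := fun n x => by
    have h1 : Q (n + 1) x - Q n x = 2 ^ n * ∑ k ∈ Finset.range (2 ^ n), (d n k x) ^ 2 := by
      change 2 ^ (n + 1) * ∑ k ∈ Finset.range (2 ^ (n + 1)), (a (n + 1) k x) ^ 2 -
        2 ^ n * ∑ k ∈ Finset.range (2 ^ n), (a n k x) ^ 2 = _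
      rw [pow_succ' (2 : ℝ) n, pow_succ' (2 : ℕ) n, sum_range_two_mul, mul_assoc, mul_left_comm,
        ← mul_sub, Finset.mul_sum, ← Finset.sum_sub_distrib]
      congr 1
      refine Finset.sum_congr rfl fun k _ => ?_
      have h2 : a (n + 1) (2 * k) = B (a n k) := splittingTree_succ_two_mul B f n k
      have h3 : a (n + 1) (2 * k + 1) = a n k - B (a n k) :=
        splittingTree_succ_two_mul_add_one B f n k
      rw [h2, h3]
      change _ = ((B (a n k) - (a n k - B (a n k))) x) ^ 2
      simp only [_root_.sub_apply]
      ring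
    rw [h1]
    have h2 : r n x = ∑ k ∈ Finset.range (2 ^ n), d n k x := by
      simp [r]
    rw [h2]
    refine sq_sum_le_card_mul_sum_sq.trans (le_of_eq ?_)
    simp
  have hlimI : ∀ (m : ℕ) (x : E), |x| ≤ m • x₀ → Tendsto (fun n => r n x) atTop (𝓝 0) := by
    intro m x hx
    have hQb : ∀ n, Q n x ≤ (m * f x₀) ^ 2 := fun n => by
      have h1 : ∀ k ∈ Finset.range (2 ^ n), (a n k x) ^ 2 ≤ (m * (f x₀ / 2 ^ n)) ^ 2 :=
        fun k _ => by
        refine sq_le_sq' ?_ ?_ <;>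
        · have h2 : |a n k x| ≤ m * (f x₀ / 2 ^ n) := by
            refine (abs_dual_apply_le_of_abs_le (abs_of_nonneg (haI n k).1).le x).trans ?_
            refine (dual_apply_mono (haI n k).1 hx).trans ?_
            rw [map_nsmul, nsmul_eq_mul]
            exact mul_le_mul_of_nonneg_left (hax n k) (Nat.cast_nonneg m)
          linarith [(abs_le.1 h2).1, (abs_le.1 h2).2]
      calc Q n x ≤ 2 ^ n * ∑ _k ∈ Finset.range (2 ^ n), (m * (f x₀ / 2 ^ n)) ^ 2 :=
            mul_le_mul_of_nonneg_left (Finset.sum_le_sum h1) (by positivity)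
        _ = (m * f x₀) ^ 2 := by
            rw [Finset.sum_const, Finset.card_range, nsmul_eq_mul]
            push_cast
            field_simp
    have hs : Summable fun n => (r n x) ^ 2 := by
      refine summable_of_sum_range_le (c := (m * f x₀) ^ 2) (fun n => sq_nonneg _) fun N => ?_
      refine (Finset.sum_le_sum fun n _ => hQ n x).trans ?_
      rw [Finset.sum_range_sub fun n => Q n x]
      have : 0 ≤ Q 0 x := mul_nonneg (by positivity) (Finset.sum_nonneg fun k _ => sq_nonneg _)
      linarith [hQb N]
    have h1 := hs.tendsto_atTop_zero.sqrt
    simp only [Real.sqrt_sq_eq_abs, Real.sqrt_zero] at h1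
    exact (tendsto_zero_iff_abs_tendsto_zero _).2 h1
  have hlim0 : ∀ x : E, 0 ≤ x → Tendsto (fun n => r n x) atTop (𝓝 0) := by
    intro x hx
    have hn : ∀ m : ℕ, 0 ≤ m • x₀ := fun m => nsmul_nonneg hx₀ m
    have h1 : Tendsto (fun m : ℕ => f (x - x ⊓ m • x₀)) atTop (𝓝 0) := by
      have h2 := (hf.tendsto x hx).const_sub (f x)
      rw [sub_self] at h2
      refine h2.congr fun m => ?_
      rw [map_sub, hf.apply_inf_nsmul hx₀ hx]
    rw [Metric.tendsto_atTop]
    intro ε hε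
    obtain ⟨m, hm⟩ := (h1.eventually (gt_mem_nhds (half_pos hε))).exists
    have h3 := hlimI m (x ⊓ m • x₀) (by
      rw [abs_of_nonneg (le_inf hx (hn m))]
      exact inf_le_right)
    obtain ⟨N, hN⟩ := (Metric.tendsto_atTop.1 h3) (ε / 2) (half_pos hε)
    refine ⟨N, fun n hnN => ?_⟩
    have h4 := hN n hnN
    rw [dist_zero_right, Real.norm_eq_abs] at h4 ⊢
    have h5 := abs_dual_apply_le_of_abs_le (hr n).le (x - x ⊓ m • x₀)
    rw [abs_of_nonneg (sub_nonneg.2 inf_le_left : 0 ≤ x - x ⊓ m • x₀)] at h5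
    have h6 : r n x = r n (x ⊓ m • x₀) + r n (x - x ⊓ m • x₀) := by rw [map_sub]; ring
    rw [h6]
    linarith [abs_add_le (r n (x ⊓ m • x₀)) (r n (x - x ⊓ m • x₀))]
  refine ⟨f, x₀, r, hx₀, hfx ▸ hfx₀, hr, fun x => ?_⟩
  have h1 := (hlim0 _ (posPart_nonneg x)).sub (hlim0 _ (negPart_nonneg x))
  rw [sub_self] at h1
  refine h1.congr fun n => ?_
  rw [← map_sub, posPart_sub_negPart]

end Rademacher

/-! ### A positive operator built from a Rademacher sequence and a disjoint sequence -/

section RademacherOperator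

set_option linter.unusedSectionVars false

variable {E : Type*} [NormedAddCommGroup E] [NormedSpace ℝ E] [Lattice E]
  [IsOrderedAddMonoid E] [HasSolidNorm E]
  {F : Type*} [NormedAddCommGroup F] [NormedSpace ℝ F] [Lattice F]
  [IsOrderedAddMonoid F] [HasSolidNorm F] [IsOrderedModule ℝ F]

theorem exists_disjoint_of_not_orderContinuousNorm [CompleteSpace F]
    (hF : ¬ OrderContinuousNorm F) :
    ∃ (w : F) (y : ℕ → F) (c : ℝ), 0 < c ∧ (∀ n, 0 ≤ y n) ∧ (∀ n, y n ≤ w) ∧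
      (Pairwise fun m n => y m ⊓ y n = 0) ∧ ∀ n, c ≤ ‖y n‖ := by
  have h : ¬ OrderBoundedDisjointNull F := fun h => hF h.orderContinuousNorm
  simp only [OrderBoundedDisjointNull, not_forall] at h
  obtain ⟨w, x, hx0, hxw, hxd, hx⟩ := h
  rw [Metric.tendsto_atTop] at hx
  push Not at hx
  obtain ⟨c, hc, hx⟩ := hx
  obtain ⟨φ, hφ, hφx⟩ := extraction_of_frequently_atTop (frequently_atTop.2 hx)
  refine ⟨w, x ∘ φ, c, hc, fun n => hx0 _, fun n => hxw _,
    fun m n hmn => hxd (hφ.injective.ne hmn), fun n => ?_⟩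
  have := hφx n
  rwa [dist_zero_right] at this

theorem abs_sum_smul_le {y : ℕ → F} {w : F} (hy0 : ∀ n, 0 ≤ y n) (hyw : ∀ n, y n ≤ w)
    (hyd : Pairwise fun m n => y m ⊓ y n = 0) {s : Finset ℕ} {α : ℕ → ℝ} {δ : ℝ} (hδ : 0 ≤ δ)
    (hα : ∀ n ∈ s, |α n| ≤ δ) : |∑ n ∈ s, α n • y n| ≤ δ • w := by
  have h1 : ∑ n ∈ s, |α n| • y n ≤ δ • w :=
    calc ∑ n ∈ s, |α n| • y n ≤ ∑ n ∈ s, δ • y n :=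
          Finset.sum_le_sum fun n hn => smul_le_smul_of_nonneg_right (hα n hn) (hy0 n)
      _ = δ • ∑ n ∈ s, y n := Finset.smul_sum.symm
      _ ≤ δ • w := smul_le_smul_of_nonneg_left
          (sum_le_of_pairwise_inf_eq_zero hy0 hyw ((hy0 0).trans (hyw 0)) hyd s) hδ
  refine abs_le'.2 ⟨le_trans (Finset.sum_le_sum fun n _ => ?_) h1, ?_⟩
  · exact smul_le_smul_of_nonneg_right (le_abs_self _) (hy0 n)
  · rw [← Finset.sum_neg_distrib]
    refine le_trans (Finset.sum_le_sum fun n _ => ?_) h1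
    rw [← neg_smul]
    exact smul_le_smul_of_nonneg_right (neg_le_abs _) (hy0 n)

theorem summable_smul_of_tendsto_zero [CompleteSpace F] {y : ℕ → F} {w : F} (hy0 : ∀ n, 0 ≤ y n)
    (hyw : ∀ n, y n ≤ w) (hyd : Pairwise fun m n => y m ⊓ y n = 0) {α : ℕ → ℝ}
    (hα : Tendsto α atTop (𝓝 0)) : Summable fun n => α n • y n := by
  rw [summable_iff_vanishing_norm]
  intro ε hε
  have hδ : 0 < ε / (‖w‖ + 1) := by positivity
  obtain ⟨N, hN⟩ := (Metric.tendsto_atTop.1 hα) _ hδ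
  refine ⟨Finset.range N, fun t ht => ?_⟩
  have h1 := norm_le_norm_of_abs_le (abs_sum_smul_le hy0 hyw hyd (s := t) (α := α) hδ.le
    fun n hn => by
      have h2 := hN n (by
        by_contra h3
        exact Finset.disjoint_left.1 ht hn (Finset.mem_range.2 (not_le.1 h3)))
      rw [dist_zero_right] at h2
      exact h2.le)
  refine h1.trans_lt ?_
  rw [norm_smul, Real.norm_of_nonneg hδ.le, div_mul_eq_mul_div, div_lt_iff₀ (by positivity)]
  nlinarith [norm_nonneg w]

/-- The operator `x ↦ ∑ r n x • y n` for a weak-star null sequence `r` of functionals with common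
modulus `f` and a disjoint sequence `y` in `[0, w]`. -/
theorem exists_operator_hasSum [CompleteSpace F] {y : ℕ → F} {w : F} (hy0 : ∀ n, 0 ≤ y n)
    (hyw : ∀ n, y n ≤ w) (hyd : Pairwise fun m n => y m ⊓ y n = 0) {f : StrongDual ℝ E}
    {r : ℕ → StrongDual ℝ E} (hr : ∀ n, |r n| = f)
    (hr0 : ∀ x, Tendsto (fun n => r n x) atTop (𝓝 0)) :
    ∃ R : E →L[ℝ] F, (∀ x, HasSum (fun n => r n x • y n) (R x)) ∧
      ∀ x, |R x| ≤ f |x| • w := by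
  have hs : ∀ x, Summable fun n => r n x • y n := fun x =>
    summable_smul_of_tendsto_zero hy0 hyw hyd (hr0 x)
  have hf : 0 ≤ f := hr 0 ▸ abs_nonneg _
  have hfx : ∀ x : E, 0 ≤ f |x| := fun x => hf _ (abs_nonneg x)
  have habs : ∀ x, |∑' n, r n x • y n| ≤ f |x| • w := fun x => by
    have h1 : ∀ s : Finset ℕ, |∑ n ∈ s, r n x • y n| ≤ f |x| • w := fun s =>
      abs_sum_smul_le hy0 hyw hyd (hfx x) fun n _ => abs_dual_apply_le_of_abs_le (hr n).le x
    refine abs_le'.2 ⟨?_, ?_⟩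
    · exact le_of_tendsto (hs x).hasSum
        (Eventually.of_forall fun s => (le_abs_self _).trans (h1 s))
    · exact le_of_tendsto (hs x).hasSum.neg
        (Eventually.of_forall fun s => by
          simpa only [Finset.sum_neg_distrib] using (neg_le_abs _).trans (h1 s))
  let L : E →ₗ[ℝ] F :=
    { toFun := fun x => ∑' n, r n x • y n
      map_add' := fun a b => by
        simp only [map_add, add_smul]
        exact (hs a).tsum_add (hs b)
      map_smul' := fun c a => by
        simp only [map_smul, smul_eq_mul, mul_smul, RingHom.id_apply]
        exact (hs a).tsum_const_smul c }
  refine ⟨L.mkContinuous (‖f‖ * ‖w‖) fun x => ?_, fun x => (hs x).hasSum, habs⟩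
  refine (norm_le_norm_of_abs_le (habs x)).trans ?_
  rw [norm_smul, mul_right_comm]
  refine mul_le_mul_of_nonneg_right ?_ (norm_nonneg _)
  rw [← norm_abs_eq_norm x]
  exact f.le_opNorm _

/-- The coordinates along a disjoint sequence are bounded by the norm of the sum. -/
theorem abs_mul_norm_le_of_hasSum {y : ℕ → F} (hy0 : ∀ n, 0 ≤ y n)
    (hyd : Pairwise fun m n => y m ⊓ y n = 0) {α : ℕ → ℝ} {z : F}
    (hz : HasSum (fun n => α n • y n) z) (n : ℕ) : |α n| * ‖y n‖ ≤ ‖z‖ := by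
  obtain ⟨g, hg0, hg1, hgy⟩ := exists_nonneg_dual_vector (y n)
  obtain ⟨p, hp⟩ := exists_isBandRestriction hg0 (hy0 n)
  have h1 : HasSum (fun m => p (α m • y m)) (p z) := p.hasSum hz
  have h2 : HasSum (fun m => p (α m • y m)) (p (α n • y n)) := hasSum_single n fun m hm => by
    rw [map_smul, hp.apply_eq_zero (hy0 n) (hy0 m) (hyd hm), smul_zero]
  have h3 : p z = α n * g (y n) := by
    rw [h1.unique h2, map_smul, hp.apply_self (hy0 n), smul_eq_mul]
  rw [abs_of_nonneg (hy0 n)] at hgy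
  calc |α n| * ‖y n‖ ≤ |α n| * g (y n) := mul_le_mul_of_nonneg_left hgy (abs_nonneg _)
    _ = ‖p z‖ := by
      rw [h3, Real.norm_eq_abs, abs_mul, abs_of_nonneg (hg0 _ (hy0 n))]
    _ ≤ ‖p‖ * ‖z‖ := p.le_opNorm z
    _ ≤ ‖z‖ := mul_le_of_le_one_left (norm_nonneg _)
      ((norm_le_norm_of_nonneg_of_le hp.nonneg hp.le).trans hg1)

theorem dual_abs_apply_le_of_forall {g : StrongDual ℝ E} {u : E} (hu : 0 ≤ u) {M : ℝ}
    (h : ∀ x ∈ Icc (-u) u, g x ≤ M) : |g| u ≤ M := by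
  rw [dual_abs_apply_of_nonneg g hu, ← le_sub_iff_add_le']
  refine dualPosCone_le _ hu fun y hy => ?_
  have h1 : g u + (-g - g) y = g (u - y - y) := by
    simp only [_root_.sub_apply, _root_.neg_apply, map_sub]
    ring
  rw [le_sub_iff_add_le', h1]
  refine h _ ⟨?_, ?_⟩
  · rw [sub_sub, neg_le_sub_iff_le_add]
    exact add_le_add hy.2 hy.2
  · rw [sub_sub]
    exact sub_le_self u (add_nonneg hy.1 hy.1)

/-- The operator `x ↦ f x • w + ∑ r n x • y n` does not map `[-x₀, x₀]` to a relatively compact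
set: the coordinates `r n x` do not tend to `0` uniformly on `[-x₀, x₀]`, as `|r n| x₀ = f x₀`. -/
theorem not_dwCompact_of_hasSum {y : ℕ → F} {w : F} (hy0 : ∀ n, 0 ≤ y n)
    (hyd : Pairwise fun m n => y m ⊓ y n = 0) {c : ℝ} (hc : 0 < c) (hcy : ∀ n, c ≤ ‖y n‖)
    {f : StrongDual ℝ E} {x₀ : E} (hx₀ : 0 ≤ x₀) (hfx₀ : 0 < f x₀)
    {r : ℕ → StrongDual ℝ E} (hr : ∀ n, |r n| = f)
    (hr0 : ∀ x, Tendsto (fun n => r n x) atTop (𝓝 0)) {R T : E →L[ℝ] F}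
    (hR : ∀ x, HasSum (fun n => r n x • y n) (R x)) (hT : ∀ x, T x = f x • w + R x) :
    ¬ DWCompact T := by
  intro hDW
  have hA := disjointWeaklyCompact_of_orderBounded (A := Icc (-x₀) x₀) bddBelow_Icc bddAbove_Icc
  have hcomp : IsCompact ((fun p : F × ℝ => p.1 - p.2 • w) ''
      (closure (T '' Icc (-x₀) x₀) ×ˢ closure (f '' Icc (-x₀) x₀))) :=
    ((hDW _ hA).prod (f.lipschitz.isBounded_image hA.1).isCompact_closure).image (by fun_prop)
  have hRA : TotallyBounded (R '' Icc (-x₀) x₀) := by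
    refine hcomp.totallyBounded.subset ?_
    rintro _ ⟨x, hx, rfl⟩
    refine ⟨(T x, f x), ⟨subset_closure (mem_image_of_mem _ hx),
      subset_closure (mem_image_of_mem _ hx)⟩, ?_⟩
    simp only [hT, add_sub_cancel_left]
  obtain ⟨t, htA, ht, hAt⟩ := exists_subset_image_finite_and.1
    (Metric.finite_approx_of_totallyBounded hRA (c * (f x₀ / 4)) (by positivity))
  have hev : ∀ᶠ n in atTop, ∀ z ∈ t, |r n z| < f x₀ / 4 := by
    refine (ht.eventually_all).2 fun z _ => ?_
    have h1 := (hr0 z).abs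
    rw [abs_zero] at h1
    exact h1.eventually (gt_mem_nhds (by positivity))
  obtain ⟨n, hn⟩ := hev.exists
  have hb : |r n| x₀ ≤ f x₀ / 2 := by
    refine dual_abs_apply_le_of_forall hx₀ fun x hx => ?_
    obtain ⟨_, ⟨z, hz, rfl⟩, hxz⟩ := mem_iUnion₂.1 (hAt (mem_image_of_mem R hx))
    rw [Metric.mem_ball, dist_eq_norm, ← map_sub] at hxz
    have h1 := abs_mul_norm_le_of_hasSum hy0 hyd (hR (x - z)) n
    have h2 : |r n (x - z)| * c ≤ |r n (x - z)| * ‖y n‖ :=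
      mul_le_mul_of_nonneg_left (hcy n) (abs_nonneg _)
    have h3 : |r n (x - z)| < f x₀ / 4 := by
      refine lt_of_mul_lt_mul_right ?_ hc.le
      linarith
    rw [map_sub] at h3
    linarith [(abs_lt.1 h3).2, (abs_lt.1 (hn z hz)).2]
  rw [hr n] at hb
  linarith

/-- On a disjoint weakly compact set of functionals, the series `∑ |g (y n)|` along a disjoint order
bounded sequence converges uniformly.  Otherwise restricting functionals of the set to the bands of
disjoint blocks of the sequence yields a disjoint sequence in the solid hull that does not tend to
`0` at the order bound. -/
theorem DisjointWeaklyCompact.exists_tail_sum_le {B : Set (StrongDual ℝ F)}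
    (hB : DisjointWeaklyCompact B) {y : ℕ → F} {w : F} (hy0 : ∀ n, 0 ≤ y n) (hyw : ∀ n, y n ≤ w)
    (hyd : Pairwise fun m n => y m ⊓ y n = 0) {ε : ℝ} (hε : 0 < ε) :
    ∃ N : ℕ, ∀ g ∈ B, ∀ M, ∑ n ∈ Finset.Ico N M, |g (y n)| ≤ ε := by
  by_contra! hcon
  choose g hgB M hM using hcon
  set N : ℕ → ℕ := fun k => M^[k] 0 with hN
  have hNs : ∀ k, N (k + 1) = M (N k) := fun k => Function.iterate_succ_apply' M k 0
  have hNm : Monotone N := monotone_nat_of_le_succ fun k => by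
    rw [hNs]
    by_contra hlt
    have h1 := hM (N k)
    rw [Finset.Ico_eq_empty_of_le (not_le.1 hlt).le, Finset.sum_empty] at h1
    exact absurd h1 hε.not_gt
  let z : ℕ → F := fun k => ∑ n ∈ Finset.Ico (N k) (N (k + 1)), y n
  have hz0 : ∀ k, 0 ≤ z k := fun k => Finset.sum_nonneg fun n _ => hy0 n
  have hzw : ∀ k, z k ≤ w := fun k =>
    sum_le_of_pairwise_inf_eq_zero hy0 hyw ((hy0 0).trans (hyw 0)) hyd _
  have hzd : Pairwise fun k l => z k ⊓ z l = 0 := pairwise_of_lt_of_inf fun k l hkl =>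
    sum_inf_sum_eq_zero (fun n _ => hy0 n) (fun n _ => hy0 n) fun i hi j hj => hyd (by
      have h1 := (Finset.mem_Ico.1 hi).2
      have h2 := (Finset.mem_Ico.1 hj).1
      have h3 : N (k + 1) ≤ N l := hNm (Nat.succ_le_of_lt hkl)
      omega)
  choose h hh using fun k => exists_isBandRestriction (abs_nonneg (g (N k))) (hz0 k)
  have hnull := hB.2 h (fun k => ⟨g (N k), hgB _, by
      rw [abs_of_nonneg (hh k).nonneg]
      exact (hh k).le⟩)
    ((disjointSeq_iff_of_nonneg fun k => (hh k).nonneg).2 fun k l hkl =>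
      (hh k).inf_eq_zero (hh l) (hz0 k) (hz0 l) (hzd hkl))
    (ContinuousLinearMap.apply ℝ ℝ w)
  obtain ⟨k, hk⟩ := (hnull.eventually (gt_mem_nhds hε)).exists
  have hk' : h k w < ε := hk
  have h1 : ∑ n ∈ Finset.Ico (N k) (N (k + 1)), |g (N k) (y n)| ≤ |g (N k)| (z k) := by
    rw [map_sum]
    refine Finset.sum_le_sum fun n _ => ?_
    have := abs_dual_apply_le_of_abs_le (le_refl |g (N k)|) (y n)
    rwa [abs_of_nonneg (hy0 n)] at this
  have h2 := hM (N k)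
  rw [← hNs] at h2
  have h3 := (hh k).apply_self (hz0 k)
  have h4 := dual_apply_mono (hh k).nonneg (hzw k)
  linarith

/-- The adjoint of `x ↦ f x • w + ∑ r n x • y n` maps `g` to `g w • f + ∑ g (y n) • r n`; on
disjoint weakly compact sets it is a uniform limit of finite rank operators. -/
theorem dwCompact_adjoint_of_hasSum {y : ℕ → F} {w : F} (hy0 : ∀ n, 0 ≤ y n)
    (hyw : ∀ n, y n ≤ w) (hyd : Pairwise fun m n => y m ⊓ y n = 0) {f : StrongDual ℝ E}
    {r : ℕ → StrongDual ℝ E} (hr : ∀ n, |r n| = f) {R T : E →L[ℝ] F}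
    (hR : ∀ x, HasSum (fun n => r n x • y n) (R x)) (hT : ∀ x, T x = f x • w + R x) :
    DWCompact (adjointOperator T) := by
  intro B hB
  refine isCompact_closure_of_totallyBounded (totallyBounded_of_approx fun ε hε => ?_)
  obtain ⟨N, hN⟩ := hB.exists_tail_sum_le hy0 hyw hyd
    (show 0 < ε / (‖f‖ + 1) by positivity)
  let Φ : StrongDual ℝ F →L[ℝ] ℝ × (Fin N → ℝ) :=
    (ContinuousLinearMap.apply ℝ ℝ w).prod
      (ContinuousLinearMap.pi fun i : Fin N => ContinuousLinearMap.apply ℝ ℝ (y i))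
  let Θ : ℝ × (Fin N → ℝ) → StrongDual ℝ E := fun p => p.1 • f + ∑ i : Fin N, p.2 i • r i
  have hΘ : Continuous Θ := by fun_prop
  refine ⟨Θ '' closure (Φ '' B),
    ((Φ.lipschitz.isBounded_image hB.1).isCompact_closure.image hΘ).totallyBounded, ?_⟩
  rintro _ ⟨g, hg, rfl⟩
  refine ⟨Θ (Φ g), mem_image_of_mem _ (subset_closure (mem_image_of_mem _ hg)), ?_⟩
  rw [dist_eq_norm]
  refine ContinuousLinearMap.opNorm_le_bound _ hε.le fun x => ?_
  have hf : 0 ≤ f := hr 0 ▸ abs_nonneg _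
  have h1 : (adjointOperator T g - Θ (Φ g)) x =
      g (R x) - ∑ n ∈ Finset.range N, r n x * g (y n) := by
    have h2 : adjointOperator T g x = f x * g w + g (R x) := by
      change g (T x) = _
      rw [hT, map_add, map_smul, smul_eq_mul]
    have h3 : Θ (Φ g) x = f x * g w + ∑ n ∈ Finset.range N, r n x * g (y n) := by
      rw [← Fin.sum_univ_eq_sum_range (fun n => r n x * g (y n))]
      change (g w • f + ∑ i : Fin N, g (y i) • r i) x = _
      simp [mul_comm]
    rw [_root_.sub_apply, h2, h3]
    ring
  have hsum : HasSum (fun n => r n x * g (y n)) (g (R x)) := by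
    have := g.hasSum (hR x)
    simpa using this
  have hlim := (hsum.tendsto_sum_nat.sub_const (∑ n ∈ Finset.range N, r n x * g (y n))).norm
  rw [h1]
  refine le_of_tendsto hlim ((eventually_ge_atTop N).mono fun M hM => ?_)
  rw [← Finset.sum_Ico_eq_sub _ hM]
  have hfx : f |x| ≤ ‖f‖ * ‖x‖ := by
    rw [← norm_abs_eq_norm x]
    exact (Real.le_norm_self _).trans (f.le_opNorm _)
  calc ‖∑ n ∈ Finset.Ico N M, r n x * g (y n)‖ ≤ ∑ n ∈ Finset.Ico N M, ‖r n x * g (y n)‖ :=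
        norm_sum_le _ _
    _ ≤ ∑ n ∈ Finset.Ico N M, f |x| * |g (y n)| := Finset.sum_le_sum fun n _ => by
        rw [Real.norm_eq_abs, abs_mul]
        exact mul_le_mul_of_nonneg_right (abs_dual_apply_le_of_abs_le (hr n).le x) (abs_nonneg _)
    _ = f |x| * ∑ n ∈ Finset.Ico N M, |g (y n)| := (Finset.mul_sum _ _ _).symm
    _ ≤ (‖f‖ * ‖x‖) * (ε / (‖f‖ + 1)) := mul_le_mul hfx (hN g hg M)
        (Finset.sum_nonneg fun n _ => abs_nonneg _) (by positivity)
    _ = ε * ‖x‖ * (‖f‖ / (‖f‖ + 1)) := by ring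
    _ ≤ ε * ‖x‖ := mul_le_of_le_one_right (by positivity)
        ((div_le_one (by positivity)).2 (by linarith))

/-- If the norm of `F` is not order continuous and the dual of `E` is not discrete, some positive
operator with DW-compact adjoint fails to be DW-compact. -/
theorem exists_positiveOperator_not_dwCompact [CompleteSpace F] (hF : ¬ OrderContinuousNorm F)
    (hE : ¬ DiscreteLattice (StrongDual ℝ E)) :
    ∃ T : E →L[ℝ] F, PositiveOperator T ∧ DWCompact (adjointOperator T) ∧ ¬ DWCompact T := by
  obtain ⟨w, y, c, hc, hy0, hyw, hyd, hcy⟩ := exists_disjoint_of_not_orderContinuousNorm hF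
  obtain ⟨f, x₀, r, hx₀, hfx₀, hr, hr0⟩ := exists_rademacher hE
  obtain ⟨R, hR, hRabs⟩ := exists_operator_hasSum hy0 hyw hyd hr hr0
  have hT : ∀ x, (f.smulRight w + R) x = f x • w + R x := fun x => rfl
  refine ⟨f.smulRight w + R, fun x hx => ?_, dwCompact_adjoint_of_hasSum hy0 hyw hyd hr hR hT,
    not_dwCompact_of_hasSum hy0 hyd hc hcy hx₀ hfx₀ hr hr0 hR hT⟩
  have h1 := (neg_le_abs (R x)).trans (hRabs x)
  rw [abs_of_nonneg hx] at h1
  rw [hT]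
  exact neg_le_iff_add_nonneg.1 h1

end RademacherOperator

/-! ### The implications -/

theorem mainTheorem1
    {E : Type*} [NormedAddCommGroup E] [NormedSpace ℝ E] [CompleteSpace E] [Lattice E]
    [IsOrderedAddMonoid E] [IsOrderedModule ℝ E] [HasSolidNorm E]
    {F : Type*} [NormedAddCommGroup F] [NormedSpace ℝ F] [CompleteSpace F] [Lattice F]
    [IsOrderedAddMonoid F] [IsOrderedModule ℝ F] [HasSolidNorm F] :
    -- (i) implies (ii)
    (PositiveSchur F →
      ∀ T : E →L[ℝ] F, RegularOperator T → AMCompact (adjointOperator T) → DWCompact T) ∧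
    -- (ii) implies (iii)
    ((∀ T : E →L[ℝ] F, RegularOperator T → AMCompact (adjointOperator T) → DWCompact T) →
      ∀ T : E →L[ℝ] F, RegularOperator T → DWCompact (adjointOperator T) → DWCompact T) ∧
    -- (iii) implies (iv)
    ((∀ T : E →L[ℝ] F, RegularOperator T → DWCompact (adjointOperator T) → DWCompact T) →
      ∀ T : E →L[ℝ] F, PositiveOperator T → DWCompact (adjointOperator T) → DWCompact T) ∧
    -- (iv) implies (v)
    ((∀ T : E →L[ℝ] F, PositiveOperator T → DWCompact (adjointOperator T) → DWCompact T) →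
      OrderContinuousNorm F ∨
      DiscreteLattice (StrongDual ℝ E) ∨
      (¬ OrderContinuousNorm (StrongDual ℝ E) ∧
        ¬ DiscreteLattice (StrongDual ℝ (StrongDual ℝ F)))) := by
  refine ⟨fun hF T hT hT' => dwCompact_of_positiveSchur hF hT hT', fun h T hT hT' =>
    h T hT fun A h1 h2 => hT' A (disjointWeaklyCompact_of_orderBounded h1 h2), fun h T hT hT' =>
    h T ⟨T, 0, hT, fun x _ => le_rfl, (sub_zero T).symm⟩ hT', fun h => ?_⟩
  -- one of the first two alternatives always holds; the third is not needed
  by_contra! hcon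
  obtain ⟨T, hT, hT', hTn⟩ := exists_positiveOperator_not_dwCompact hcon.1 hcon.2.1
  exact hTn (h T hT hT')
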